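/- Let $x_{t+1}=Ax_t+Bu_t$ with $A\in\mathbb R^{n\times n}$, $B\in\mathbb R^{n\times m}$, let $Q\succeq 0$, $R\succ 0$, $P\succeq 0$, let $H_i\succeq 0$ for $i$ in a finite index set $\mathcal I$, and suppose that $(A,B)$ is stabilizable and $(A,\sqrt Q)$ is detectable. For a horizon $T$, vectors $c_{i|t}$, $e_t$, scalars $d_{i|t}$, matrices $G_t$ and dual variables $\lambda_{i|t}\ge 0$, $\mu_t\ge 0$ $(0\le t<T)$ put $Q_{\lambda|t}=Q+\sum_i\lambda_{i|t}H_i$ and consider the Lagrangian cost-to-go $$x_T^\top Px_T+\sum_{k=t}^{T-1}\Big(x_k^\top Q_{\lambda|k}x_k+\sum_i\lambda_{i|k}(c_{i|k}^\top x_k+d_{i|k})+\mu_k^\top(G_ku_k+e_k)+u_k^\top Ru_k\Big).$$ Let $F_T=P$, $S_T=0$ and, for $t<T$, with $M_t=B^\top F_{t+1}B+R$ and $K_t=M_t^{-1}B^\top F_{t+1}A$, $$F_t=A^\top F_{t+1}A+Q_{\lambda|t}-A^\top F_{t+1}BM_t^{-1}B^\top F_{t+1}A,$$ $$S_t=\sum_i\lambda_{i|t}c_{i|t}+A^\top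 S_{t+1}-K_t^\top(B^\top S_{t+1}+G_t^\top\mu_t),$$ $$u_t^*(x,\lambda,\mu)=-K_tx+l_t,\qquad l_t=-\tfrac12M_t^{-1}(B^\top S_{t+1}+G_t^\top\mu_t).$$ Then the following hold. (a) $(A,\sqrt{Q+\sum_i\lambda_iH_i})$ is detectable for all $\lambda_i\ge0$. (b) For every $t\le T$ and every state $x_t$, the law $u^*$ minimizes the Lagrangian cost-to-go over all input sequences. (c) The law $u^*$ stabilizes the system: for every $\Lambda\in\mathbb R$ there are $C>0$ and $\alpha\in(0,1)$, depending only on $A,B,Q,R,P,(H_i)$ and $\Lambda$, such that, with $\|\cdot\|$ the maximum norm: (c1) for every horizon $T$, all $c,d,G,e$ and all dual variables with $0\le\lambda_{i|t}\le\Lambda$ and $\mu_t\ge0$ for $0\le t<T$, any two trajectories $x,y$ of the closed loop $x_{k+1}=Ax_k+Bu_k^*(x_k,\lambda,\mu)$ on $[r,T]$ satisfy $$\|x_t-y_t\|\le C\alpha^{t-r}\|x_r-y_r\|\qquad(r\le t\le T);$$ (c2) if moreover $\lambda,\mu,c,G$ do not depend on time, then for each fixed $t$ the gain $K_t$ and the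 offset $l_t$ for horizon $T$ converge as $T\to\infty$ to limits $K_\infty$ and $l_\infty$ that do not depend on $t$; the spectral radius of $A-BK_\infty$ is less than $1$; and the closed loop $x_{t+1}=Ax_t+B(-K_\infty x_t+l_\infty)$ has an equilibrium $\bar x$ such that every solution satisfies $\|x_t-\bar x\|\le C\alpha^t\|x_0-\bar x\|$ for all $t\ge 0$. -/

import Mathlib

open Filter Topology Matrix
open scoped MatrixOrder

noncomputable section

/-- A real square matrix is Schur stable if its spectral radius (the largest modulus of its
complex eigenvalues) is smaller than one. -/
def SchurStable {n : ℕ} (A : Matrix (Fin n) (Fin n) ℝ) : Prop :=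
  spectralRadius ℂ (A.map (fun a : ℝ => (a : ℂ))) < 1

/-- `(A, B)` is stabilizable: some static state feedback makes the closed loop Schur stable. -/
def Stabilizable {n m : ℕ} (A : Matrix (Fin n) (Fin n) ℝ) (B : Matrix (Fin n) (Fin m) ℝ) : Prop :=
  ∃ K : Matrix (Fin m) (Fin n) ℝ, SchurStable (A + B * K)

/-- `(A, C)` is detectable: some output injection makes the error dynamics Schur stable. -/
def Detectable {n p : ℕ} (A : Matrix (Fin n) (Fin n) ℝ) (C : Matrix (Fin p) (Fin n) ℝ) : Prop :=
  ∃ L : Matrix (Fin n) (Fin p) ℝ, SchurStable (A - L * C)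

/-- The system matrices `A, B`, the weights `Q, R, P` of the quadratic cost, and the Hessians
`H i` of the convexified state constraints. -/
structure LQR (n m : ℕ) (ι : Type*) where
  A : Matrix (Fin n) (Fin n) ℝ
  B : Matrix (Fin n) (Fin m) ℝ
  Q : Matrix (Fin n) (Fin n) ℝ
  R : Matrix (Fin m) (Fin m) ℝ
  P : Matrix (Fin n) (Fin n) ℝ
  H : ι → Matrix (Fin n) (Fin n) ℝ

/-- The standing assumptions on the system and the weights. -/
structure LQR.Standing {n m : ℕ} {ι : Type*} (L : LQR n m ι) : Prop where
  stabilizable : Stabilizable L.A L.B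
  posSemidef_Q : L.Q.PosSemidef
  posDef_R : L.R.PosDef
  posSemidef_P : L.P.PosSemidef
  posSemidef_H : ∀ i, (L.H i).PosSemidef
  detectable : Detectable L.A (CFC.sqrt L.Q)

/-- The affine parts of the constraints: at time `t` they read
`xᵀ Hᵢ x + c t i ⬝ x + d t i ≤ 0` for the state and `G t * u + e t ≤ 0` for the input. -/
structure AffineData (n m s : ℕ) (ι : Type*) where
  c : ℕ → ι → Fin n → ℝ
  d : ℕ → ι → ℝ
  G : ℕ → Matrix (Fin s) (Fin m) ℝ
  e : ℕ → Fin s → ℝ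

namespace LQR

variable {n m s : ℕ} {ι : Type*} [Fintype ι]

/-- The auxiliary weight `Q_λ = Q + ∑ᵢ λᵢ Hᵢ` belonging to the multipliers of one time instant. -/
def Qlam (L : LQR n m ι) (lam : ι → ℝ) : Matrix (Fin n) (Fin n) ℝ :=
  L.Q + ∑ i, lam i • L.H i

/-- The stage cost of the Lagrangian at time `t`. -/
def stageCost (L : LQR n m ι) (D : AffineData n m s ι) (lam : ℕ → ι → ℝ) (mu : ℕ → Fin s → ℝ)
    (t : ℕ) (x : Fin n → ℝ) (u : Fin m → ℝ) : ℝ :=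
  x ⬝ᵥ (L.Qlam (lam t) *ᵥ x) + (∑ i, lam t i • D.c t i) ⬝ᵥ x + lam t ⬝ᵥ D.d t
    + mu t ⬝ᵥ (D.G t *ᵥ u + D.e t) + u ⬝ᵥ (L.R *ᵥ u)

/-- The Lagrangian cost over `t, …, T` of a state sequence `x` and an input sequence `u`. -/
def costToGo (L : LQR n m ι) (D : AffineData n m s ι) (lam : ℕ → ι → ℝ) (mu : ℕ → Fin s → ℝ)
    (T t : ℕ) (x : ℕ → Fin n → ℝ) (u : ℕ → Fin m → ℝ) : ℝ :=
  x T ⬝ᵥ (L.P *ᵥ x T) + ∑ k ∈ Finset.Ico t T, L.stageCost D lam mu k (x k) (u k)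

/-- `M = R + Bᵀ F B`. -/
def M (L : LQR n m ι) (F : Matrix (Fin n) (Fin n) ℝ) : Matrix (Fin m) (Fin m) ℝ :=
  L.Bᵀ * F * L.B + L.R

/-- `K = M⁻¹ Bᵀ F A`. -/
def K (L : LQR n m ι) (F : Matrix (Fin n) (Fin n) ℝ) : Matrix (Fin m) (Fin n) ℝ :=
  (L.M F)⁻¹ * L.Bᵀ * F * L.A

/-- One backward step `Aᵀ F A + Q_λ - Aᵀ F B M⁻¹ Bᵀ F A` of the Riccati recursion. -/
def riccatiStep (L : LQR n m ι) (lam : ι → ℝ) (F : Matrix (Fin n) (Fin n) ℝ) :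
    Matrix (Fin n) (Fin n) ℝ :=
  L.Aᵀ * F * L.A + L.Qlam lam - L.Aᵀ * F * L.B * (L.M F)⁻¹ * L.Bᵀ * F * L.A

/-- The Riccati recursion for the horizon `T`, indexed by the number `k` of steps to go:
`Fback T k` is the matrix of the quadratic part of the cost-to-go at time `T - k`. -/
def Fback (L : LQR n m ι) (lam : ℕ → ι → ℝ) (T : ℕ) : ℕ → Matrix (Fin n) (Fin n) ℝ
  | 0 => L.P
  | k + 1 => L.riccatiStep (lam (T - (k + 1))) (Fback L lam T k)

/-- The matrix `F_t` for the horizon `T` (meaningful for `t ≤ T`). -/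
def F (L : LQR n m ι) (lam : ℕ → ι → ℝ) (T t : ℕ) : Matrix (Fin n) (Fin n) ℝ :=
  L.Fback lam T (T - t)

/-- One backward step, to time `t`, of the recursion for the linear part of the cost-to-go:
`S_tᵀ = ∑ᵢ λᵢ cᵢᵀ + Sᵀ A - (Sᵀ B + μ_tᵀ G_t) M⁻¹ Bᵀ F A`, where `F = F_{t+1}` and `S = S_{t+1}`. -/
def linStep (L : LQR n m ι) (D : AffineData n m s ι) (lam : ℕ → ι → ℝ) (mu : ℕ → Fin s → ℝ)
    (t : ℕ) (F : Matrix (Fin n) (Fin n) ℝ) (S : Fin n → ℝ) : Fin n → ℝ :=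
  (∑ i, lam t i • D.c t i) + L.Aᵀ *ᵥ S
    - (L.K F)ᵀ *ᵥ (L.Bᵀ *ᵥ S + (D.G t)ᵀ *ᵥ mu t)

/-- The recursion for the linear part of the cost-to-go, indexed by the steps to go. -/
def Sback (L : LQR n m ι) (D : AffineData n m s ι) (lam : ℕ → ι → ℝ) (mu : ℕ → Fin s → ℝ)
    (T : ℕ) : ℕ → Fin n → ℝ
  | 0 => 0
  | k + 1 => L.linStep D lam mu (T - (k + 1)) (Fback L lam T k) (Sback L D lam mu T k)

/-- The vector `S_t` for the horizon `T` (meaningful for `t ≤ T`). -/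
def S (L : LQR n m ι) (D : AffineData n m s ι) (lam : ℕ → ι → ℝ) (mu : ℕ → Fin s → ℝ)
    (T t : ℕ) : Fin n → ℝ :=
  L.Sback D lam mu T (T - t)

/-- The offset `l_t` of the optimal law. -/
def offset (L : LQR n m ι) (D : AffineData n m s ι) (lam : ℕ → ι → ℝ) (mu : ℕ → Fin s → ℝ)
    (T t : ℕ) : Fin m → ℝ :=
  -((1 / 2 : ℝ) • ((L.M (L.F lam T (t + 1)))⁻¹ *ᵥ
    (L.Bᵀ *ᵥ L.S D lam mu T (t + 1) + (D.G t)ᵀ *ᵥ mu t)))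

/-- The optimal law `u_t^*(x, λ, μ) = -K_t x + l_t` for the horizon `T` (meaningful for `t < T`). -/
def law (L : LQR n m ι) (D : AffineData n m s ι) (lam : ℕ → ι → ℝ) (mu : ℕ → Fin s → ℝ)
    (T t : ℕ) (x : Fin n → ℝ) : Fin m → ℝ :=
  -(L.K (L.F lam T (t + 1)) *ᵥ x) + L.offset D lam mu T t

/-- `x` is a trajectory, from time `t` up to time `T`, of the system driven by the inputs `u`. -/
def IsTrajectory (L : LQR n m ι) (t T : ℕ) (x : ℕ → Fin n → ℝ) (u : ℕ → Fin m → ℝ) : Prop :=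
  ∀ k, t ≤ k → k < T → x (k + 1) = L.A *ᵥ x k + L.B *ᵥ u k

end LQR

end

/-! Optimality is dynamic programming: completing the square (`complete_square`) turns the
cost-to-go into the value `xᵀ F_t x + S_t ⬝ x`, plus constants, plus nonnegative weighted deviations
from the law (`costToGo_eq`). Detectability survives because `Q ≤ Q_λ` puts the kernel of `√Q_λ`
inside that of `√Q`; hence `√Q` factors through `√Q_λ`, and the factor is absorbed into the observer
gain.

Uniform stability is a Lyapunov argument. The difference of two closed-loop trajectories obeys the
homogeneous loop, along which `xᵀ F_t x` drops by the stage cost. As `Q` may be singular, this drop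
need not control the state. Detectability supplies the rest: in a norm `N` adapted to the observer,
`N²` contracts up to `γ` times the stage cost (`exists_observer_norm`), so `W = γ xᵀ F_t x + N²`
loses at least `(1 - θ) N²` per step. Stabilizability bounds `F_t` uniformly in the horizon
(`exists_form_F_le`), so `W` is comparable to `N²` and decays geometrically
(`exists_closedLoop_decay`). The observer belongs to `Q` alone and the multipliers enter the upper
bound only through `Λ`; this is what makes the rate uniform.

For time-invariant data, the difference of two Riccati steps factors through the two closed loops
(`riccatiStep_sub_riccatiStep`). By the uniform decay, successive horizons differ by `O(α^(2k))`, so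
`F` converges. The limiting loop inherits the decay as a limit of finite-horizon loops, and `S`
follows an affine recursion whose matrix tends to a Schur stable one. -/

noncomputable section

/-! ### Schur stable matrices: power bounds, adapted norms, equilibria. -/

section SchurStability

variable {n : ℕ}

section OperatorNorm

attribute [local instance] Matrix.linftyOpNormedAddCommGroup Matrix.linftyOpNormedSpace
  Matrix.linftyOpNormedRing Matrix.linftyOpNormedAlgebra

theorem Matrix.exists_norm_mulVec_le {m n : ℕ} (A : Matrix (Fin m) (Fin n) ℝ) :
    ∃ a : ℝ, 0 ≤ a ∧ ∀ x, ‖A *ᵥ x‖ ≤ a * ‖x‖ :=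
  ⟨‖A‖, norm_nonneg A, fun x => Matrix.linfty_opNorm_mulVec A x⟩

/-- Spectral radii are complex while the dynamics are real; the row-sum norm does not see the
difference. -/
theorem Matrix.norm_map_ofReal (A : Matrix (Fin n) (Fin n) ℝ) :
    ‖A.map (fun a : ℝ => (a : ℂ))‖ = ‖A‖ := by
  simp [Matrix.linfty_opNorm_def]

theorem Matrix.map_ofReal_pow (A : Matrix (Fin n) (Fin n) ℝ) (k : ℕ) :
    (A ^ k).map (fun a : ℝ => (a : ℂ)) = (A.map (fun a : ℝ => (a : ℂ))) ^ k :=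
  map_pow (RingHom.mapMatrix (m := Fin n) Complex.ofRealHom) A k

theorem Matrix.linfty_opNorm_le_of_mulVec_le {A : Matrix (Fin n) (Fin n) ℝ} {c : ℝ} (hc : 0 ≤ c)
    (h : ∀ x, ‖A *ᵥ x‖ ≤ c * ‖x‖) : ‖A‖ ≤ c := by
  rw [Matrix.linfty_opNorm_eq_opNorm]
  exact ContinuousLinearMap.opNorm_le_bound _ hc h

/-- Some power of a Schur stable matrix is a contraction of the maximum norm. -/
theorem SchurStable.exists_pow_mulVec_le {A : Matrix (Fin n) (Fin n) ℝ} (hA : SchurStable A) :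
    ∃ (θ : ℝ) (m : ℕ), 0 < θ ∧ θ < 1 ∧ 1 ≤ m ∧ ∀ x, ‖A ^ m *ᵥ x‖ ≤ θ ^ m * ‖x‖ := by
  obtain ⟨q, hq1, hq2⟩ := ENNReal.lt_iff_exists_nnreal_btwn.1 hA
  have hq0 : 0 < q := ENNReal.coe_pos.1 (bot_le.trans_lt hq1)
  have hq3 : q < 1 := by exact_mod_cast hq2
  -- Gelfand's formula, with `q` strictly between the spectral radius and one.
  have hev := (spectrum.pow_nnnorm_pow_one_div_tendsto_nhds_spectralRadius
    (A.map (fun a : ℝ => (a : ℂ)))).eventually (gt_mem_nhds hq1)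
  obtain ⟨m, hm, hm1⟩ := (hev.and (eventually_ge_atTop 1)).exists
  refine ⟨q, m, hq0, hq3, hm1, fun x => ?_⟩
  have hm0 : (m : ℝ) ≠ 0 := by positivity
  have h1 : ‖(A.map (fun a : ℝ => (a : ℂ))) ^ m‖₊ ≤ q ^ m := by
    have h2 := ENNReal.rpow_le_rpow hm.le (z := m) (by positivity)
    rw [← ENNReal.rpow_mul, one_div_mul_cancel hm0, ENNReal.rpow_one, ENNReal.rpow_natCast] at h2
    exact_mod_cast h2
  have h3 : ‖A ^ m‖ ≤ (q : ℝ) ^ m := by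
    rw [← Matrix.norm_map_ofReal, Matrix.map_ofReal_pow]
    exact_mod_cast h1
  exact (Matrix.linfty_opNorm_mulVec _ _).trans
    (mul_le_mul_of_nonneg_right h3 (norm_nonneg _))

theorem schurStable_of_pow_mulVec_le {A : Matrix (Fin n) (Fin n) ℝ} {C α : ℝ} (hα0 : 0 ≤ α)
    (hα : α < 1) (h : ∀ k x, ‖A ^ k *ᵥ x‖ ≤ C * α ^ k * ‖x‖) : SchurStable A := by
  have hC : Tendsto (fun k : ℕ => |C| * α ^ (k + 1)) atTop (𝓝 0) := by
    simpa using (((tendsto_pow_atTop_nhds_zero_of_lt_one hα0 hα).comp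
      (tendsto_add_atTop_nat 1)).const_mul |C|)
  obtain ⟨k, hk⟩ := (hC.eventually (gt_mem_nhds one_pos)).exists
  have hle : ‖A ^ (k + 1)‖ ≤ |C| * α ^ (k + 1) := by
    refine Matrix.linfty_opNorm_le_of_mulVec_le (by positivity) fun x => (h _ x).trans ?_
    gcongr
    exact le_abs_self C
  have h1 : ‖(A.map (fun a : ℝ => (a : ℂ))) ^ (k + 1)‖₊ < 1 := by
    have : ‖(A.map (fun a : ℝ => (a : ℂ))) ^ (k + 1)‖ < 1 := by
      rw [← Matrix.map_ofReal_pow, Matrix.norm_map_ofReal]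
      exact hle.trans_lt hk
    exact_mod_cast this
  -- Only an inequality: for `n = 0` the identity has norm zero.
  have h2 : ‖(1 : Matrix (Fin n) (Fin n) ℂ)‖₊ ≤ 1 := by
    rw [← Matrix.diagonal_one, Matrix.linfty_opNNNorm_diagonal]
    exact pi_nnnorm_le_iff.2 fun i => by simp
  refine (spectrum.spectralRadius_le_pow_nnnorm_pow_one_div ℂ _ k).trans_lt ?_
  have hpos : (0 : ℝ) < 1 / ((k : ℝ) + 1) := by positivity
  calc _ ≤ (‖(A.map (fun a : ℝ => (a : ℂ))) ^ (k + 1)‖₊ : ENNReal) ^ (1 / ((k : ℝ) + 1)) * 1 := by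
        gcongr
        exact ENNReal.rpow_le_one (by exact_mod_cast h2) hpos.le
    _ < 1 := by
        rw [mul_one]
        exact ENNReal.rpow_lt_one (by exact_mod_cast h1) hpos

end OperatorNorm

theorem SchurStable.transpose {A : Matrix (Fin n) (Fin n) ℝ} (hA : SchurStable A) :
    SchurStable Aᵀ := by
  have h : spectrum ℂ (Aᵀ.map (fun a : ℝ => (a : ℂ)))
      = spectrum ℂ (A.map (fun a : ℝ => (a : ℂ))) := by
    ext z
    rw [spectrum.mem_iff, spectrum.mem_iff, ← Matrix.isUnit_transpose, Matrix.transpose_sub,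
      Matrix.transpose_map, Matrix.transpose_transpose, Algebra.algebraMap_eq_smul_one,
      Matrix.transpose_smul, Matrix.transpose_one]
  unfold SchurStable spectralRadius
  rw [h]
  exact hA

/-- A Schur stable matrix contracts some norm equivalent to the maximum norm. -/
theorem SchurStable.exists_adapted_norm {A : Matrix (Fin n) (Fin n) ℝ} (hA : SchurStable A) :
    ∃ (N : (Fin n → ℝ) → ℝ) (θ a : ℝ), 0 < θ ∧ θ < 1 ∧ 0 < a ∧ (∀ x, ‖x‖ ≤ N x) ∧
      (∀ x, N x ≤ a * ‖x‖) ∧ (∀ x y, N (x + y) ≤ N x + N y) ∧ ∀ x, N (A *ᵥ x) ≤ θ * N x := by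
  obtain ⟨θ, m, hθ0, hθ1, hm, hle⟩ := hA.exists_pow_mulVec_le
  choose b hb0 hb using fun k => Matrix.exists_norm_mulVec_le (A ^ k)
  -- Replacing `x` by `A x` shifts the sum: up to the factor `θ`, the term `‖x‖` is traded for `θ⁻ᵐ
  -- ‖Aᵐ x‖ ≤ ‖x‖`. The summand `1` in the upper constant only makes it positive.
  refine ⟨fun x => ∑ k ∈ Finset.range m, (θ ^ k)⁻¹ * ‖A ^ k *ᵥ x‖, θ,
    1 + ∑ k ∈ Finset.range m, (θ ^ k)⁻¹ * b k, hθ0, hθ1, ?_, fun x => ?_, fun x => ?_,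
    fun x y => ?_, fun x => ?_⟩
  · have : 0 ≤ ∑ k ∈ Finset.range m, (θ ^ k)⁻¹ * b k :=
      Finset.sum_nonneg fun k _ => mul_nonneg (by positivity) (hb0 k)
    linarith
  · have := Finset.single_le_sum (f := fun k => (θ ^ k)⁻¹ * ‖A ^ k *ᵥ x‖)
      (s := Finset.range m) (fun k _ => by positivity) (Finset.mem_range.2 (by omega : 0 < m))
    simpa using this
  · rw [add_mul, Finset.sum_mul]
    refine (Finset.sum_le_sum fun k _ => ?_).trans (le_add_of_nonneg_left (by positivity))
    rw [mul_assoc]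
    exact mul_le_mul_of_nonneg_left (hb k x) (by positivity)
  · rw [← Finset.sum_add_distrib]
    refine Finset.sum_le_sum fun k _ => ?_
    rw [← mul_add, Matrix.mulVec_add]
    exact mul_le_mul_of_nonneg_left (norm_add_le _ _) (by positivity)
  · have h1 : ∀ k, (θ ^ k)⁻¹ * ‖A ^ k *ᵥ (A *ᵥ x)‖
        = θ * ((θ ^ (k + 1))⁻¹ * ‖A ^ (k + 1) *ᵥ x‖) := fun k => by
      rw [Matrix.mulVec_mulVec, ← pow_succ]
      field_simp
      ring
    have h2 : (θ ^ m)⁻¹ * ‖A ^ m *ᵥ x‖ ≤ ‖x‖ := by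
      rw [inv_mul_le_iff₀ (by positivity)]
      exact hle x
    simp only [h1]
    rw [← Finset.mul_sum]
    refine mul_le_mul_of_nonneg_left ?_ hθ0.le
    have h3 := Finset.sum_range_succ (fun k => (θ ^ k)⁻¹ * ‖A ^ k *ᵥ x‖) m
    rw [Finset.sum_range_succ'] at h3
    simp only [pow_zero, inv_one, one_mul, Matrix.one_mulVec] at h3
    linarith

theorem SchurStable.tendsto_pow_mulVec {A : Matrix (Fin n) (Fin n) ℝ} (hA : SchurStable A)
    (x : Fin n → ℝ) : Tendsto (fun k => A ^ k *ᵥ x) atTop (𝓝 0) := by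
  obtain ⟨N, θ, a, hθ0, hθ1, -, hN1, -, -, hN⟩ := hA.exists_adapted_norm
  refine squeeze_zero_norm (a := fun k => θ ^ k * N x) (fun k => (hN1 _).trans ?_) (by
    simpa using (tendsto_pow_atTop_nhds_zero_of_lt_one hθ0.le hθ1).mul_const (N x))
  induction k with
  | zero => simp
  | succ k ih =>
    rw [pow_succ', ← Matrix.mulVec_mulVec]
    calc _ ≤ θ * N (A ^ k *ᵥ x) := hN _
      _ ≤ θ * (θ ^ k * N x) := by gcongr
      _ = _ := by ring

/-- An affine system with a Schur stable matrix has an equilibrium. -/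
theorem SchurStable.exists_equilibrium {A : Matrix (Fin n) (Fin n) ℝ} (hA : SchurStable A)
    (w : Fin n → ℝ) : ∃ x, x = A *ᵥ x + w := by
  -- A fixed point of `A` equals `Aᵏ x` for all `k`, hence is zero; in finite dimension `1 - A` is
  -- then onto.
  have hinj : Function.Injective (Matrix.mulVecLin (1 - A)) := by
    rw [injective_iff_map_eq_zero]
    intro x hx
    have hx' : A *ᵥ x = x := by
      rw [Matrix.mulVecLin_apply, Matrix.sub_mulVec, Matrix.one_mulVec, sub_eq_zero] at hx
      exact hx.symm
    have hk : ∀ k, A ^ k *ᵥ x = x := fun k => by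
      induction k with
      | zero => simp
      | succ k ih => rw [pow_succ, ← Matrix.mulVec_mulVec, hx', ih]
    have := hA.tendsto_pow_mulVec x
    simp only [hk] at this
    exact tendsto_nhds_unique tendsto_const_nhds this
  obtain ⟨x, hx⟩ := LinearMap.surjective_of_injective hinj w
  refine ⟨x, ?_⟩
  rw [← hx, Matrix.mulVecLin_apply, Matrix.sub_mulVec, Matrix.one_mulVec]
  abel

end SchurStability

/-- A perturbed contraction converges to zero if the perturbation does. -/
theorem tendsto_zero_of_le_mul_add {u δ : ℕ → ℝ} {θ : ℝ} (hθ0 : 0 ≤ θ) (hθ1 : θ < 1)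
    (hu : ∀ k, 0 ≤ u k) (hδ : Tendsto δ atTop (𝓝 0))
    (h : ∀ᶠ k in atTop, u (k + 1) ≤ θ * u k + δ k) : Tendsto u atTop (𝓝 0) := by
  refine tendsto_order.2 ⟨fun b hb => Eventually.of_forall fun k => hb.trans_le (hu k),
    fun ε hε => ?_⟩
  -- The threshold makes `ε / 2` the fixed point of the majorant `v ↦ θ v + (1 - θ) ε / 2`.
  have hδ' : ∀ᶠ k in atTop, δ k < (1 - θ) * (ε / 2) :=
    hδ.eventually (gt_mem_nhds (mul_pos (by linarith) (by linarith)))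
  obtain ⟨k₀, hk₀⟩ := eventually_atTop.1 (h.and hδ')
  have hle : ∀ j, u (k₀ + j) ≤ ε / 2 + θ ^ j * u k₀ := fun j => by
    induction j with
    | zero => simp; linarith
    | succ j ih =>
      obtain ⟨h1, h2⟩ := hk₀ (k₀ + j) (by omega)
      have h3 := mul_le_mul_of_nonneg_left ih hθ0
      rw [← add_assoc, pow_succ]
      nlinarith
  have hlim : Tendsto (fun j => ε / 2 + θ ^ j * u k₀) atTop (𝓝 (ε / 2 + 0 * u k₀)) :=
    tendsto_const_nhds.add ((tendsto_pow_atTop_nhds_zero_of_lt_one hθ0 hθ1).mul_const _)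
  obtain ⟨j₀, hj₀⟩ := eventually_atTop.1 (hlim.eventually (gt_mem_nhds (by linarith : ε / 2 + 0 * u k₀ < ε)))
  refine eventually_atTop.2 ⟨k₀ + j₀, fun k hk => ?_⟩
  obtain ⟨j, rfl⟩ : ∃ j, k = k₀ + j := ⟨k - k₀, by omega⟩
  exact (hle j).trans_lt (hj₀ j (by omega))

/-! ### Quadratic forms in the maximum norm, square roots, factorization. -/

section QuadraticForms

variable {n : ℕ}

theorem abs_dotProduct_le (x y : Fin n → ℝ) : |x ⬝ᵥ y| ≤ n * (‖x‖ * ‖y‖) := by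
  refine (Finset.abs_sum_le_sum_abs _ _).trans ?_
  refine (Finset.sum_le_card_nsmul _ _ (‖x‖ * ‖y‖) fun i _ => ?_).trans (by simp)
  rw [abs_mul]
  exact mul_le_mul (norm_le_pi_norm x i) (norm_le_pi_norm y i) (abs_nonneg _) (norm_nonneg _)

theorem sq_norm_le_dotProduct_self (x : Fin n → ℝ) : ‖x‖ ^ 2 ≤ x ⬝ᵥ x := by
  have h0 : 0 ≤ x ⬝ᵥ x := Finset.sum_nonneg fun i _ => mul_self_nonneg _
  rw [← Real.le_sqrt (norm_nonneg _) h0, pi_norm_le_iff_of_nonneg (Real.sqrt_nonneg _)]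
  intro i
  rw [Real.norm_eq_abs]
  refine Real.abs_le_sqrt ?_
  rw [sq]
  exact Finset.single_le_sum (f := fun i => x i * x i) (fun i _ => mul_self_nonneg _)
    (Finset.mem_univ i)

theorem Matrix.exists_abs_form_le (X : Matrix (Fin n) (Fin n) ℝ) :
    ∃ c : ℝ, 0 ≤ c ∧ ∀ x y, |x ⬝ᵥ (X *ᵥ y)| ≤ c * (‖x‖ * ‖y‖) := by
  obtain ⟨a, ha0, ha⟩ := X.exists_norm_mulVec_le
  refine ⟨n * a, by positivity, fun x y => (abs_dotProduct_le _ _).trans ?_⟩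
  calc _ ≤ n * (‖x‖ * (a * ‖y‖)) := by gcongr; exact ha y
    _ = _ := by ring

theorem Matrix.exists_form_le (X : Matrix (Fin n) (Fin n) ℝ) :
    ∃ c : ℝ, 0 ≤ c ∧ ∀ x, x ⬝ᵥ (X *ᵥ x) ≤ c * ‖x‖ ^ 2 := by
  obtain ⟨c, hc0, hc⟩ := X.exists_abs_form_le
  exact ⟨c, hc0, fun x => by rw [sq]; exact (le_abs_self _).trans (hc x x)⟩

theorem Matrix.PosSemidef.form_nonneg {X : Matrix (Fin n) (Fin n) ℝ} (hX : X.PosSemidef)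
    (x : Fin n → ℝ) : 0 ≤ x ⬝ᵥ (X *ᵥ x) := by
  simpa using hX.dotProduct_mulVec_nonneg x

theorem Matrix.PosSemidef.transpose_eq {X : Matrix (Fin n) (Fin n) ℝ} (hX : X.PosSemidef) :
    Xᵀ = X := by
  simpa using hX.isHermitian.eq

theorem Matrix.dotProduct_mulVec_comm {m n : ℕ} (X : Matrix (Fin m) (Fin n) ℝ) (x : Fin m → ℝ)
    (y : Fin n → ℝ) : x ⬝ᵥ (X *ᵥ y) = y ⬝ᵥ (Xᵀ *ᵥ x) := by
  rw [Matrix.mulVec_transpose, Matrix.dotProduct_mulVec, dotProduct_comm]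

theorem Matrix.dotProduct_congr_mulVec {m p q : ℕ} (X : Matrix (Fin m) (Fin p) ℝ)
    (F : Matrix (Fin m) (Fin n) ℝ) (Y : Matrix (Fin n) (Fin q) ℝ) (x : Fin p → ℝ)
    (y : Fin q → ℝ) : x ⬝ᵥ ((Xᵀ * F * Y) *ᵥ y) = (X *ᵥ x) ⬝ᵥ (F *ᵥ (Y *ᵥ y)) := by
  rw [← Matrix.mulVec_mulVec, ← Matrix.mulVec_mulVec, Matrix.dotProduct_mulVec_comm Xᵀ,
    Matrix.transpose_transpose, dotProduct_comm]

theorem Matrix.PosSemidef.form_eq_sqrt {X : Matrix (Fin n) (Fin n) ℝ} (hX : X.PosSemidef)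
    (x : Fin n → ℝ) : x ⬝ᵥ (X *ᵥ x) = (CFC.sqrt X *ᵥ x) ⬝ᵥ (CFC.sqrt X *ᵥ x) := by
  have h1 : CFC.sqrt X * CFC.sqrt X = X :=
    CFC.sqrt_mul_sqrt_self X (Matrix.nonneg_iff_posSemidef.2 hX)
  have h2 : (CFC.sqrt X)ᵀ = CFC.sqrt X :=
    (Matrix.nonneg_iff_posSemidef.1 (CFC.sqrt_nonneg X)).transpose_eq
  rw [Matrix.dotProduct_mulVec_comm (CFC.sqrt X), h2, Matrix.mulVec_mulVec, h1]

theorem Matrix.PosSemidef.sq_norm_sqrt_le {X : Matrix (Fin n) (Fin n) ℝ} (hX : X.PosSemidef)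
    (x : Fin n → ℝ) : ‖CFC.sqrt X *ᵥ x‖ ^ 2 ≤ x ⬝ᵥ (X *ᵥ x) := by
  rw [hX.form_eq_sqrt]
  exact sq_norm_le_dotProduct_self _

/-- Coercivity comes from invertibility: `x = (X⁻¹ √X)(√X x)`, and `‖√X x‖²` is at most the form. -/
theorem Matrix.PosDef.exists_le_form {X : Matrix (Fin n) (Fin n) ℝ} (hX : X.PosDef) :
    ∃ r : ℝ, 0 < r ∧ ∀ x, r * ‖x‖ ^ 2 ≤ x ⬝ᵥ (X *ᵥ x) := by
  obtain ⟨a, ha0, ha⟩ := (X⁻¹ * CFC.sqrt X).exists_norm_mulVec_le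
  have h1 : CFC.sqrt X * CFC.sqrt X = X :=
    CFC.sqrt_mul_sqrt_self X (Matrix.nonneg_iff_posSemidef.2 hX.posSemidef)
  have hle : ∀ x, ‖x‖ ≤ (a + 1) * ‖CFC.sqrt X *ᵥ x‖ := fun x => by
    have h2 := ha (CFC.sqrt X *ᵥ x)
    rw [Matrix.mulVec_mulVec, Matrix.mul_assoc, h1,
      Matrix.nonsing_inv_mul _ ((Matrix.isUnit_iff_isUnit_det _).1 hX.isUnit),
      Matrix.one_mulVec] at h2
    nlinarith [norm_nonneg (CFC.sqrt X *ᵥ x)]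
  refine ⟨((a + 1) ^ 2)⁻¹, by positivity, fun x => ?_⟩
  rw [inv_mul_le_iff₀ (by positivity)]
  calc ‖x‖ ^ 2 ≤ ((a + 1) * ‖CFC.sqrt X *ᵥ x‖) ^ 2 := by gcongr; exact hle x
    _ = (a + 1) ^ 2 * ‖CFC.sqrt X *ᵥ x‖ ^ 2 := by ring
    _ ≤ _ := by gcongr; exact hX.posSemidef.sq_norm_sqrt_le x

/-- A matrix that vanishes on the kernel of another one factors through it. -/
theorem Matrix.exists_eq_mul_of_ker_le {p q : ℕ} {C : Matrix (Fin p) (Fin n) ℝ}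
    {D : Matrix (Fin q) (Fin n) ℝ} (h : ∀ x, D *ᵥ x = 0 → C *ᵥ x = 0) :
    ∃ X : Matrix (Fin p) (Fin q) ℝ, C = X * D := by
  -- The factor is `C ∘ g`, where `g` extends a section of `D` over its range; `x - g (D x)` lies in
  -- the kernel of `D`, hence in that of `C`.
  obtain ⟨s, hs⟩ := D.mulVecLin.rangeRestrict.exists_rightInverse_of_surjective
    (LinearMap.range_rangeRestrict _)
  obtain ⟨g, hg⟩ := LinearMap.exists_extend s
  refine ⟨LinearMap.toMatrix' (C.mulVecLin ∘ₗ g), ?_⟩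
  refine Matrix.ext_of_mulVec_single fun i => ?_
  set x : Fin n → ℝ := Pi.single i 1
  rw [← Matrix.mulVec_mulVec, LinearMap.toMatrix'_mulVec, LinearMap.comp_apply,
    Matrix.mulVecLin_apply]
  have h1 : g (D *ᵥ x) = s (D.mulVecLin.rangeRestrict x) :=
    LinearMap.congr_fun hg (D.mulVecLin.rangeRestrict x)
  have h2 : D *ᵥ s (D.mulVecLin.rangeRestrict x) = D *ᵥ x :=
    congrArg Subtype.val (LinearMap.congr_fun hs (D.mulVecLin.rangeRestrict x))
  have h3 := h (x - g (D *ᵥ x)) (by rw [Matrix.mulVec_sub, h1, h2, sub_self])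
  rwa [Matrix.mulVec_sub, sub_eq_zero] at h3

end QuadraticForms

/-! ### The Riccati step, detectability and optimality. -/

namespace LQR

section Gain

variable {n m : ℕ} {ι : Type*}

/-- The closed-loop matrix `A - B K` of the feedback gain belonging to `F`. -/
def closedLoop (L : LQR n m ι) (F : Matrix (Fin n) (Fin n) ℝ) : Matrix (Fin n) (Fin n) ℝ :=
  L.A - L.B * L.K F

variable {L : LQR n m ι} {F : Matrix (Fin n) (Fin n) ℝ}

theorem M_posDef (hL : L.Standing) (hF : F.PosSemidef) : (L.M F).PosDef := by
  have := hF.conjTranspose_mul_mul_same L.B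
  rw [Matrix.conjTranspose_eq_transpose_of_trivial] at this
  exact Matrix.PosDef.posSemidef_add this hL.posDef_R

theorem isUnit_det_M (hL : L.Standing) (hF : F.PosSemidef) : IsUnit (L.M F).det :=
  (Matrix.isUnit_iff_isUnit_det _).1 (M_posDef hL hF).isUnit

theorem M_mul_K (hM : IsUnit (L.M F).det) : L.M F * L.K F = L.Bᵀ * F * L.A := by
  simp only [K, ← Matrix.mul_assoc]
  rw [Matrix.mul_nonsing_inv _ hM, Matrix.one_mul]

theorem K_transpose_mul_M (hL : L.Standing) (hF : F.PosSemidef) :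
    (L.K F)ᵀ * L.M F = L.Aᵀ * F * L.B := by
  have h := congrArg Matrix.transpose (M_mul_K (isUnit_det_M hL hF))
  simpa [Matrix.transpose_mul, hF.transpose_eq, (M_posDef hL hF).posSemidef.transpose_eq,
    Matrix.mul_assoc] using h

end Gain

variable {n m s : ℕ} {ι : Type*} [Fintype ι] {L : LQR n m ι} {F : Matrix (Fin n) (Fin n) ℝ}

theorem riccatiStep_eq_sub (hL : L.Standing) (hF : F.PosSemidef) (lam : ι → ℝ) :
    L.riccatiStep lam F
      = L.Aᵀ * F * L.A + L.Qlam lam - (L.K F)ᵀ * L.M F * L.K F := by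
  rw [K_transpose_mul_M hL hF]
  simp only [riccatiStep, K, Matrix.mul_assoc]

/-- Completion of the square in one step of the dynamic programming recursion. -/
theorem complete_square (hL : L.Standing) (hF : F.PosSemidef) (lam : ι → ℝ) (S : Fin n → ℝ)
    (g l : Fin m → ℝ) (hl : l = -((1 / 2 : ℝ) • ((L.M F)⁻¹ *ᵥ (L.Bᵀ *ᵥ S + g))))
    (x : Fin n → ℝ) (u : Fin m → ℝ) :
    (L.A *ᵥ x + L.B *ᵥ u) ⬝ᵥ (F *ᵥ (L.A *ᵥ x + L.B *ᵥ u)) + S ⬝ᵥ (L.A *ᵥ x + L.B *ᵥ u)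
        + x ⬝ᵥ (L.Qlam lam *ᵥ x) + g ⬝ᵥ u + u ⬝ᵥ (L.R *ᵥ u)
      = x ⬝ᵥ (L.riccatiStep lam F *ᵥ x)
        + (L.Aᵀ *ᵥ S - (L.K F)ᵀ *ᵥ (L.Bᵀ *ᵥ S + g)) ⬝ᵥ x
        + (u + L.K F *ᵥ x - l) ⬝ᵥ (L.M F *ᵥ (u + L.K F *ᵥ x - l)) - l ⬝ᵥ (L.M F *ᵥ l) := by
  have hM := isUnit_det_M hL hF
  have hMT : (L.M F)ᵀ = L.M F := (M_posDef hL hF).posSemidef.transpose_eq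
  -- With this `l`, the terms linear in `u` coming from `S` and `g` are exactly the cross term `-2 u
  -- ⬝ M l` of the completed square.
  have hMl : L.M F *ᵥ l = -((1 / 2 : ℝ) • (L.Bᵀ *ᵥ S + g)) := by
    rw [hl, Matrix.mulVec_neg, Matrix.mulVec_smul, Matrix.mulVec_mulVec,
      Matrix.mul_nonsing_inv _ hM, Matrix.one_mulVec]
  have hsymm : ∀ v w : Fin m → ℝ, v ⬝ᵥ (L.M F *ᵥ w) = w ⬝ᵥ (L.M F *ᵥ v) := fun v w => by
    rw [Matrix.dotProduct_mulVec_comm, hMT]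
  have hFs : ∀ v w : Fin n → ℝ, v ⬝ᵥ (F *ᵥ w) = w ⬝ᵥ (F *ᵥ v) := fun v w => by
    rw [Matrix.dotProduct_mulVec_comm, hF.transpose_eq]
  have hric : x ⬝ᵥ (L.riccatiStep lam F *ᵥ x) = (L.A *ᵥ x) ⬝ᵥ (F *ᵥ (L.A *ᵥ x))
      + x ⬝ᵥ (L.Qlam lam *ᵥ x) - (L.K F *ᵥ x) ⬝ᵥ (L.M F *ᵥ (L.K F *ᵥ x)) := by
    rw [riccatiStep_eq_sub hL hF, Matrix.sub_mulVec, Matrix.add_mulVec, dotProduct_sub,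
      dotProduct_add, Matrix.dotProduct_congr_mulVec, Matrix.dotProduct_congr_mulVec]
  have hcross : (L.B *ᵥ u) ⬝ᵥ (F *ᵥ (L.A *ᵥ x)) = u ⬝ᵥ (L.M F *ᵥ (L.K F *ᵥ x)) := by
    rw [← Matrix.dotProduct_congr_mulVec, ← M_mul_K hM, Matrix.mulVec_mulVec]
  have hMu : u ⬝ᵥ (L.M F *ᵥ u) = (L.B *ᵥ u) ⬝ᵥ (F *ᵥ (L.B *ᵥ u)) + u ⬝ᵥ (L.R *ᵥ u) := by
    rw [M, Matrix.add_mulVec, dotProduct_add, Matrix.dotProduct_congr_mulVec]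
  have hSA : (L.Aᵀ *ᵥ S) ⬝ᵥ x = S ⬝ᵥ (L.A *ᵥ x) := by
    rw [dotProduct_comm, Matrix.dotProduct_mulVec_comm L.A]
  have hSB : (L.Bᵀ *ᵥ S) ⬝ᵥ u = S ⬝ᵥ (L.B *ᵥ u) := by
    rw [dotProduct_comm, Matrix.dotProduct_mulVec_comm L.B]
  have hKb : ((L.K F)ᵀ *ᵥ (L.Bᵀ *ᵥ S + g)) ⬝ᵥ x = (L.Bᵀ *ᵥ S + g) ⬝ᵥ (L.K F *ᵥ x) := by
    rw [dotProduct_comm, Matrix.dotProduct_mulVec_comm (L.K F)]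
  have hul : ∀ v : Fin m → ℝ, v ⬝ᵥ (L.M F *ᵥ l) = -(1 / 2) * ((L.Bᵀ *ᵥ S + g) ⬝ᵥ v) :=
    fun v => by
      rw [hMl, dotProduct_neg, dotProduct_smul, smul_eq_mul, dotProduct_comm]
      ring
  have hFAB := hFs (L.A *ᵥ x) (L.B *ᵥ u)
  have hbu : (L.Bᵀ *ᵥ S + g) ⬝ᵥ u = S ⬝ᵥ (L.B *ᵥ u) + g ⬝ᵥ u := by
    rw [add_dotProduct, hSB]
  have h1 := hul u
  have h2 := hul (L.K F *ᵥ x)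
  have h3 := hsymm u l
  have h4 := hsymm (L.K F *ᵥ x) l
  have h5 := hsymm (L.K F *ᵥ x) u
  rw [sub_dotProduct (L.Aᵀ *ᵥ S), hKb, hSA, hric]
  simp only [Matrix.mulVec_add, Matrix.mulVec_sub, dotProduct_add, dotProduct_sub,
    add_dotProduct, sub_dotProduct] at *
  linarith

theorem riccatiStep_isSymm (hL : L.Standing) (hF : F.PosSemidef) {lam : ι → ℝ} :
    (L.riccatiStep lam F).IsSymm := by
  have hQ : (L.Qlam lam)ᵀ = L.Qlam lam := by
    simp only [Qlam, Matrix.transpose_add, Matrix.transpose_sum, Matrix.transpose_smul,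
      hL.posSemidef_Q.transpose_eq, (hL.posSemidef_H _).transpose_eq]
  rw [Matrix.IsSymm, riccatiStep_eq_sub hL hF]
  simp only [Matrix.transpose_sub, Matrix.transpose_add, Matrix.transpose_mul,
    Matrix.transpose_transpose, hF.transpose_eq, hQ,
    (M_posDef hL hF).posSemidef.transpose_eq, Matrix.mul_assoc]

theorem Qlam_posSemidef (hL : L.Standing) {lam : ι → ℝ} (hlam : ∀ i, 0 ≤ lam i) :
    (L.Qlam lam).PosSemidef :=
  hL.posSemidef_Q.add (Matrix.posSemidef_sum _ fun i _ => (hL.posSemidef_H i).smul (hlam i))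

theorem form_Qlam (lam : ι → ℝ) (x : Fin n → ℝ) :
    x ⬝ᵥ (L.Qlam lam *ᵥ x) = x ⬝ᵥ (L.Q *ᵥ x) + ∑ i, lam i * (x ⬝ᵥ (L.H i *ᵥ x)) := by
  simp only [Qlam, Matrix.add_mulVec, dotProduct_add, Matrix.sum_mulVec, dotProduct_sum,
    Matrix.smul_mulVec, dotProduct_smul, smul_eq_mul]

theorem form_Q_le_form_Qlam (hL : L.Standing) {lam : ι → ℝ} (hlam : ∀ i, 0 ≤ lam i)
    (x : Fin n → ℝ) : x ⬝ᵥ (L.Q *ᵥ x) ≤ x ⬝ᵥ (L.Qlam lam *ᵥ x) := by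
  rw [form_Qlam]
  exact le_add_of_nonneg_right (Finset.sum_nonneg fun i _ =>
    mul_nonneg (hlam i) ((hL.posSemidef_H i).form_nonneg x))

theorem exists_form_Qlam_le (hL : L.Standing) (Λ : ℝ) :
    ∃ q : ℝ, 0 ≤ q ∧ ∀ lam : ι → ℝ, (∀ i, lam i ≤ Λ) → ∀ x,
      x ⬝ᵥ (L.Qlam lam *ᵥ x) ≤ q * ‖x‖ ^ 2 := by
  obtain ⟨q, hq0, hq⟩ := L.Q.exists_form_le
  choose h hh0 hh using fun i => (L.H i).exists_form_le
  refine ⟨q + ∑ i, |Λ| * h i, add_nonneg hq0 (Finset.sum_nonneg fun i _ =>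
    mul_nonneg (abs_nonneg _) (hh0 i)), fun lam hlam x => ?_⟩
  rw [form_Qlam, add_mul, Finset.sum_mul]
  refine add_le_add (hq x) (Finset.sum_le_sum fun i _ => ?_)
  rw [mul_assoc]
  exact mul_le_mul ((hlam i).trans (le_abs_self Λ)) (hh i x)
    ((hL.posSemidef_H i).form_nonneg x) (abs_nonneg _)

/-- The detectability hypothesis survives the addition of convex state constraints. -/
theorem detectable_sqrt_Qlam (hL : L.Standing) {lam : ι → ℝ} (hlam : ∀ i, 0 ≤ lam i) :
    Detectable L.A (CFC.sqrt (L.Qlam lam)) := by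
  have hker : ∀ x, CFC.sqrt (L.Qlam lam) *ᵥ x = 0 → CFC.sqrt L.Q *ᵥ x = 0 := fun x hx => by
    -- On the kernel of `√Q_λ` the form of `Q` is squeezed between zero and the vanishing form of
    -- `Q_λ`.
    have h1 := form_Q_le_form_Qlam hL hlam x
    rw [(Qlam_posSemidef hL hlam).form_eq_sqrt, hx, dotProduct_zero] at h1
    have h2 := (hL.posSemidef_Q.sq_norm_sqrt_le x).trans h1
    exact norm_eq_zero.1 (pow_eq_zero_iff two_ne_zero |>.1 (le_antisymm h2 (sq_nonneg _)))
  obtain ⟨X, hX⟩ := Matrix.exists_eq_mul_of_ker_le hker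
  obtain ⟨Y, hY⟩ := hL.detectable
  exact ⟨Y * X, by rwa [Matrix.mul_assoc, ← hX]⟩

/-- The Riccati step is a minimum over inputs, so any input gives an upper bound; a stabilizing
feedback will be inserted. -/
theorem form_riccatiStep_le (hL : L.Standing) (hF : F.PosSemidef) (lam : ι → ℝ)
    (x : Fin n → ℝ) (u : Fin m → ℝ) :
    x ⬝ᵥ (L.riccatiStep lam F *ᵥ x) ≤
      (L.A *ᵥ x + L.B *ᵥ u) ⬝ᵥ (F *ᵥ (L.A *ᵥ x + L.B *ᵥ u)) + x ⬝ᵥ (L.Qlam lam *ᵥ x)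
        + u ⬝ᵥ (L.R *ᵥ u) := by
  have h := complete_square hL hF lam 0 0 0 (by simp) x u
  have h2 := (M_posDef hL hF).posSemidef.form_nonneg (u + L.K F *ᵥ x - 0)
  simp only [Matrix.mulVec_zero, zero_dotProduct, add_zero, sub_zero] at h h2
  linarith

/-- Equality at the minimizing input. This yields both positivity of the recursion and the Lyapunov
decrease. -/
theorem form_riccatiStep_eq (hL : L.Standing) (hF : F.PosSemidef) (lam : ι → ℝ)
    (x : Fin n → ℝ) :
    x ⬝ᵥ (L.riccatiStep lam F *ᵥ x) =
      (L.closedLoop F *ᵥ x) ⬝ᵥ (F *ᵥ (L.closedLoop F *ᵥ x)) + x ⬝ᵥ (L.Qlam lam *ᵥ x)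
        + (L.K F *ᵥ x) ⬝ᵥ (L.R *ᵥ (L.K F *ᵥ x)) := by
  have h := complete_square hL hF lam 0 0 0 (by simp) x (-(L.K F *ᵥ x))
  have hcl : L.A *ᵥ x + L.B *ᵥ (-(L.K F *ᵥ x)) = L.closedLoop F *ᵥ x := by
    rw [closedLoop, Matrix.sub_mulVec, Matrix.mulVec_neg, Matrix.mulVec_mulVec, sub_eq_add_neg]
  rw [hcl] at h
  simp only [Matrix.mulVec_zero, zero_dotProduct, add_zero, sub_zero, neg_add_cancel,
    Matrix.mulVec_neg, dotProduct_neg, neg_dotProduct, neg_neg] at h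
  linarith

theorem riccatiStep_posSemidef (hL : L.Standing) (hF : F.PosSemidef) {lam : ι → ℝ}
    (hlam : ∀ i, 0 ≤ lam i) : (L.riccatiStep lam F).PosSemidef := by
  refine Matrix.PosSemidef.of_dotProduct_mulVec_nonneg ?_ fun x => ?_
  · exact (Matrix.conjTranspose_eq_transpose_of_trivial _).trans (riccatiStep_isSymm hL hF)
  · rw [star_trivial, form_riccatiStep_eq hL hF]
    have h1 := hF.form_nonneg (L.closedLoop F *ᵥ x)
    have h2 := (Qlam_posSemidef hL hlam).form_nonneg x
    have h3 := hL.posDef_R.posSemidef.form_nonneg (L.K F *ᵥ x)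
    linarith

theorem Fback_posSemidef (hL : L.Standing) {lam : ℕ → ι → ℝ} {T : ℕ}
    (hlam : ∀ t < T, ∀ i, 0 ≤ lam t i) : ∀ k ≤ T, (L.Fback lam T k).PosSemidef
  | 0, _ => hL.posSemidef_P
  | k + 1, hk => riccatiStep_posSemidef hL (Fback_posSemidef hL hlam k (by omega))
      (hlam _ (by omega))

theorem F_posSemidef (hL : L.Standing) {lam : ℕ → ι → ℝ} {T : ℕ}
    (hlam : ∀ t < T, ∀ i, 0 ≤ lam t i) (t : ℕ) : (L.F lam T t).PosSemidef :=
  Fback_posSemidef hL hlam _ (Nat.sub_le _ _)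

theorem F_self (lam : ℕ → ι → ℝ) (T : ℕ) : L.F lam T T = L.P := by
  simp [LQR.F, Fback]

theorem F_eq_riccatiStep (lam : ℕ → ι → ℝ) {T t : ℕ} (ht : t < T) :
    L.F lam T t = L.riccatiStep (lam t) (L.F lam T (t + 1)) := by
  have h : T - t = (T - (t + 1)) + 1 := by omega
  have h2 : T - (T - (t + 1) + 1) = t := by omega
  rw [LQR.F, h, Fback, h2, LQR.F]

theorem S_self (D : AffineData n m s ι) (lam : ℕ → ι → ℝ) (mu : ℕ → Fin s → ℝ) (T : ℕ) :
    L.S D lam mu T T = 0 := by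
  simp [LQR.S, Sback]

theorem S_eq_linStep (D : AffineData n m s ι) (lam : ℕ → ι → ℝ) (mu : ℕ → Fin s → ℝ) {T t : ℕ}
    (ht : t < T) : L.S D lam mu T t
      = L.linStep D lam mu t (L.F lam T (t + 1)) (L.S D lam mu T (t + 1)) := by
  have h : T - t = (T - (t + 1)) + 1 := by omega
  have h2 : T - (T - (t + 1) + 1) = t := by omega
  rw [LQR.S, h, Sback, h2, LQR.F, LQR.S]

/-- The part of the optimal cost-to-go contributed by one time step independently of the state. -/
def costConst (L : LQR n m ι) (D : AffineData n m s ι) (lam : ℕ → ι → ℝ) (mu : ℕ → Fin s → ℝ)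
    (T t : ℕ) : ℝ :=
  lam t ⬝ᵥ D.d t + mu t ⬝ᵥ D.e t
    - L.offset D lam mu T t ⬝ᵥ (L.M (L.F lam T (t + 1)) *ᵥ L.offset D lam mu T t)

theorem stageCost_eq (hL : L.Standing) (D : AffineData n m s ι) {lam : ℕ → ι → ℝ}
    (mu : ℕ → Fin s → ℝ) {T t : ℕ} (hlam : ∀ t < T, ∀ i, 0 ≤ lam t i) (ht : t < T)
    (x : Fin n → ℝ) (u : Fin m → ℝ) :
    L.stageCost D lam mu t x u
        + ((L.A *ᵥ x + L.B *ᵥ u) ⬝ᵥ (L.F lam T (t + 1) *ᵥ (L.A *ᵥ x + L.B *ᵥ u))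
          + L.S D lam mu T (t + 1) ⬝ᵥ (L.A *ᵥ x + L.B *ᵥ u))
      = x ⬝ᵥ (L.F lam T t *ᵥ x) + L.S D lam mu T t ⬝ᵥ x + L.costConst D lam mu T t
        + (u - L.law D lam mu T t x) ⬝ᵥ
          (L.M (L.F lam T (t + 1)) *ᵥ (u - L.law D lam mu T t x)) := by
  have h := complete_square hL (F_posSemidef hL hlam (t + 1)) (lam t) (L.S D lam mu T (t + 1))
    ((D.G t)ᵀ *ᵥ mu t) (L.offset D lam mu T t) rfl x u
  have hlaw : u - L.law D lam mu T t x
      = u + L.K (L.F lam T (t + 1)) *ᵥ x - L.offset D lam mu T t := by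
    rw [law]; abel
  have hG : mu t ⬝ᵥ (D.G t *ᵥ u) = ((D.G t)ᵀ *ᵥ mu t) ⬝ᵥ u := by
    rw [Matrix.dotProduct_mulVec_comm, dotProduct_comm]
  rw [F_eq_riccatiStep lam ht, S_eq_linStep D lam mu ht, hlaw, stageCost, costConst, linStep,
    dotProduct_add (mu t), hG, add_sub_assoc,
    add_dotProduct (∑ i, lam t i • D.c t i)]
  linarith

/-- The cost-to-go exceeds its minimum by the weighted squared deviations from the law. -/
theorem costToGo_eq (hL : L.Standing) (D : AffineData n m s ι) {lam : ℕ → ι → ℝ}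
    (mu : ℕ → Fin s → ℝ) {T t : ℕ} (hlam : ∀ t < T, ∀ i, 0 ≤ lam t i) (ht : t ≤ T)
    {x : ℕ → Fin n → ℝ} {u : ℕ → Fin m → ℝ} (h : L.IsTrajectory t T x u) :
    L.costToGo D lam mu T t x u = x t ⬝ᵥ (L.F lam T t *ᵥ x t) + L.S D lam mu T t ⬝ᵥ x t
      + ∑ k ∈ Finset.Ico t T, (L.costConst D lam mu T k
        + (u k - L.law D lam mu T k (x k)) ⬝ᵥ
          (L.M (L.F lam T (k + 1)) *ᵥ (u k - L.law D lam mu T k (x k)))) := by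
  -- The stage identities telescope in the value function, by induction on the end `r` of the
  -- window.
  have key : ∀ r, t ≤ r → r ≤ T →
      (x r ⬝ᵥ (L.F lam T r *ᵥ x r) + L.S D lam mu T r ⬝ᵥ x r)
        + ∑ k ∈ Finset.Ico t r, L.stageCost D lam mu k (x k) (u k)
      = x t ⬝ᵥ (L.F lam T t *ᵥ x t) + L.S D lam mu T t ⬝ᵥ x t
      + ∑ k ∈ Finset.Ico t r, (L.costConst D lam mu T k
        + (u k - L.law D lam mu T k (x k)) ⬝ᵥ
          (L.M (L.F lam T (k + 1)) *ᵥ (u k - L.law D lam mu T k (x k)))) := by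
    intro r hr
    induction r, hr using Nat.le_induction with
    | base => simp
    | succ r hr ih =>
      intro hrT
      have h1 := ih (by omega)
      have h2 := stageCost_eq hL D mu hlam (by omega : r < T) (x r) (u r)
      rw [Finset.sum_Ico_succ_top hr, Finset.sum_Ico_succ_top hr, h r hr (by omega)]
      linarith
  have h1 := key T ht le_rfl
  rw [F_self, S_self, zero_dotProduct, add_zero] at h1
  exact h1

theorem costToGo_law_le (hL : L.Standing) (D : AffineData n m s ι) {lam : ℕ → ι → ℝ}
    (mu : ℕ → Fin s → ℝ) {T t : ℕ} (hlam : ∀ t < T, ∀ i, 0 ≤ lam t i) (ht : t ≤ T)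
    {x y : ℕ → Fin n → ℝ} {u : ℕ → Fin m → ℝ} (hy : L.IsTrajectory t T y u)
    (hx : L.IsTrajectory t T x fun k => L.law D lam mu T k (x k)) (hxy : x t = y t) :
    L.costToGo D lam mu T t x (fun k => L.law D lam mu T k (x k)) ≤
      L.costToGo D lam mu T t y u := by
  rw [costToGo_eq hL D mu hlam ht hy, costToGo_eq hL D mu hlam ht hx, hxy]
  refine add_le_add_right (Finset.sum_le_sum fun k _ => add_le_add_right ?_ _) _
  rw [sub_self, zero_dotProduct]
  exact (M_posDef hL (F_posSemidef hL hlam _)).posSemidef.form_nonneg _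

end LQR

/-! ### Uniform exponential stability of the closed loop. -/

namespace LQR

variable {n m s : ℕ} {ι : Type*} {L : LQR n m ι}

/-- Detectability lets the stage cost dominate the part of the closed loop that is not contracted
by the norm adapted to the stable observer. -/
theorem exists_observer_norm (hL : L.Standing) :
    ∃ (N : (Fin n → ℝ) → ℝ) (θ a γ : ℝ), 0 < θ ∧ θ < 1 ∧ 0 < a ∧ 0 < γ ∧ (∀ x, ‖x‖ ≤ N x) ∧
      (∀ x, N x ≤ a * ‖x‖) ∧ ∀ x u, N (L.A *ᵥ x + L.B *ᵥ u) ^ 2 ≤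
        θ * N x ^ 2 + γ * (x ⬝ᵥ (L.Q *ᵥ x) + u ⬝ᵥ (L.R *ᵥ u)) := by
  obtain ⟨Y, hY⟩ := hL.detectable
  obtain ⟨N, θ, a, hθ0, hθ1, ha, hN1, hN2, hNadd, hN⟩ := hY.exists_adapted_norm
  obtain ⟨y, hy0, hy⟩ := Y.exists_norm_mulVec_le
  obtain ⟨b, hb0, hb⟩ := L.B.exists_norm_mulVec_le
  obtain ⟨ρ, hρ0, hρ⟩ := hL.posDef_R.exists_le_form
  have hθ' : 0 < 1 - θ := by linarith
  -- The final `+ 1` keeps `γ` positive even if `Y` and `B` vanish.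
  refine ⟨N, θ, a, 2 * a ^ 2 * (y ^ 2 + b ^ 2 / ρ) / (1 - θ) + 1, hθ0, hθ1, ha, by positivity,
    hN1, hN2, fun x u => ?_⟩
  have hN0 : ∀ x, 0 ≤ N x := fun x => (norm_nonneg x).trans (hN1 x)
  set σ := ‖CFC.sqrt L.Q *ᵥ x‖ with hσ
  set τ := ‖u‖ with hτ
  set w := a * (y * σ + b * τ) with hw
  -- Observer error dynamics plus a remainder that `√Q x` and `u`, hence the stage cost, control.
  have hdec : L.A *ᵥ x + L.B *ᵥ u = (L.A - Y * CFC.sqrt L.Q) *ᵥ x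
      + (Y *ᵥ (CFC.sqrt L.Q *ᵥ x) + L.B *ᵥ u) := by
    rw [Matrix.sub_mulVec, Matrix.mulVec_mulVec]; abel
  have h1 : N (L.A *ᵥ x + L.B *ᵥ u) ≤ θ * N x + w := by
    rw [hdec]
    refine (hNadd _ _).trans (add_le_add (hN x) ((hN2 _).trans ?_))
    exact mul_le_mul_of_nonneg_left ((norm_add_le _ _).trans (add_le_add (hy _) (hb _))) ha.le
  -- Convexity of the square with weights `θ` and `1 - θ` at the points `N x` and `w / (1 - θ)`.
  have hsq : (θ * N x + w) ^ 2 ≤ θ * N x ^ 2 + w ^ 2 / (1 - θ) := by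
    have : θ * N x ^ 2 + w ^ 2 / (1 - θ) - (θ * N x + w) ^ 2
        = θ / (1 - θ) * ((1 - θ) * N x - w) ^ 2 := by
      field_simp; ring
    have h2 : 0 ≤ θ / (1 - θ) * ((1 - θ) * N x - w) ^ 2 := by positivity
    linarith
  have hQ := hL.posSemidef_Q.sq_norm_sqrt_le x
  have hD : σ ^ 2 + ρ * τ ^ 2 ≤ x ⬝ᵥ (L.Q *ᵥ x) + u ⬝ᵥ (L.R *ᵥ u) := add_le_add hQ (hρ u)
  have hD0 : 0 ≤ σ ^ 2 + ρ * τ ^ 2 := by positivity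
  have hw2 : w ^ 2 ≤ 2 * a ^ 2 * (y ^ 2 + b ^ 2 / ρ) * (σ ^ 2 + ρ * τ ^ 2) := by
    have e : (y ^ 2 + b ^ 2 / ρ) * (σ ^ 2 + ρ * τ ^ 2)
        = y ^ 2 * σ ^ 2 + b ^ 2 * τ ^ 2 + (y ^ 2 * ρ * τ ^ 2 + b ^ 2 / ρ * σ ^ 2) := by
      field_simp; ring
    have e2 : 0 ≤ y ^ 2 * ρ * τ ^ 2 + b ^ 2 / ρ * σ ^ 2 := by positivity
    have e3 : (y * σ + b * τ) ^ 2 ≤ 2 * ((y ^ 2 + b ^ 2 / ρ) * (σ ^ 2 + ρ * τ ^ 2)) := by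
      rw [e]; nlinarith [sq_nonneg (y * σ - b * τ)]
    calc w ^ 2 = a ^ 2 * (y * σ + b * τ) ^ 2 := by rw [hw]; ring
      _ ≤ a ^ 2 * (2 * ((y ^ 2 + b ^ 2 / ρ) * (σ ^ 2 + ρ * τ ^ 2))) := by gcongr
      _ = _ := by ring
  calc N (L.A *ᵥ x + L.B *ᵥ u) ^ 2 ≤ (θ * N x + w) ^ 2 := by
        gcongr
        exact hN0 _
    _ ≤ θ * N x ^ 2 + w ^ 2 / (1 - θ) := hsq
    _ ≤ θ * N x ^ 2
        + 2 * a ^ 2 * (y ^ 2 + b ^ 2 / ρ) * (σ ^ 2 + ρ * τ ^ 2) / (1 - θ) := by gcongr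
    _ = θ * N x ^ 2
        + 2 * a ^ 2 * (y ^ 2 + b ^ 2 / ρ) / (1 - θ) * (σ ^ 2 + ρ * τ ^ 2) := by ring
    _ ≤ θ * N x ^ 2
        + (2 * a ^ 2 * (y ^ 2 + b ^ 2 / ρ) / (1 - θ) + 1) * (σ ^ 2 + ρ * τ ^ 2) := by
      gcongr
      linarith
    _ ≤ _ := by gcongr

variable [Fintype ι]

/-- Stabilizability bounds the cost-to-go matrices uniformly in the horizon. -/
theorem exists_form_F_le (hL : L.Standing) (Λ : ℝ) :
    ∃ β : ℝ, 0 ≤ β ∧ ∀ (T : ℕ) (lam : ℕ → ι → ℝ), (∀ t < T, ∀ i, 0 ≤ lam t i ∧ lam t i ≤ Λ) →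
      ∀ t x, x ⬝ᵥ (L.F lam T t *ᵥ x) ≤ β * ‖x‖ ^ 2 := by
  obtain ⟨K₀, hK₀⟩ := hL.stabilizable
  obtain ⟨N, θ, a, hθ0, hθ1, ha, hN1, hN2, -, hN⟩ := hK₀.exists_adapted_norm
  obtain ⟨q, hq0, hq⟩ := exists_form_Qlam_le hL Λ
  obtain ⟨ρ, hρ0, hρ⟩ := L.R.exists_form_le
  obtain ⟨p, hp0, hp⟩ := L.P.exists_form_le
  obtain ⟨κ, hκ0, hκ⟩ := K₀.exists_norm_mulVec_le
  have hN0 : ∀ x, 0 ≤ N x := fun x => (norm_nonneg x).trans (hN1 x)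
  have hθ2 : 0 < 1 - θ ^ 2 := by nlinarith
  set b := q + ρ * κ ^ 2 with hb
  have hb0 : 0 ≤ b := by positivity
  -- Chosen to dominate the terminal weight and to be preserved by one step under `K₀`: `β θ² + b ≤
  -- β`, where `b` bounds the stage cost.
  set β := p + b / (1 - θ ^ 2) with hβ
  have hβ0 : 0 ≤ β := by positivity
  have hββ : β * θ ^ 2 + b ≤ β := by
    have : b / (1 - θ ^ 2) * (1 - θ ^ 2) = b := div_mul_cancel₀ _ hθ2.ne'
    have : 0 ≤ p * (1 - θ ^ 2) := by positivity
    rw [hβ]; nlinarith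
  refine ⟨β * a ^ 2, by positivity, fun T lam hlam t x => ?_⟩
  have key : ∀ k ≤ T, ∀ x, x ⬝ᵥ (L.Fback lam T k *ᵥ x) ≤ β * N x ^ 2 := by
    intro k
    induction k with
    | zero =>
      intro _ x
      calc _ ≤ p * ‖x‖ ^ 2 := hp x
        _ ≤ β * N x ^ 2 := by
          have : p ≤ β := le_add_of_nonneg_right (by positivity)
          gcongr
          exact hN1 x
    | succ k ih =>
      intro hk x
      have h1 := form_riccatiStep_le hL
        (Fback_posSemidef hL (fun t ht i => (hlam t ht i).1) k (by omega))
        (lam (T - (k + 1))) x (K₀ *ᵥ x)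
      have h2 : L.A *ᵥ x + L.B *ᵥ (K₀ *ᵥ x) = (L.A + L.B * K₀) *ᵥ x := by
        rw [Matrix.add_mulVec, Matrix.mulVec_mulVec]
      rw [h2] at h1
      have h3 := ih (by omega) ((L.A + L.B * K₀) *ᵥ x)
      have h4 : β * N ((L.A + L.B * K₀) *ᵥ x) ^ 2 ≤ β * (θ * N x) ^ 2 := by
        gcongr
        · exact hN0 _
        · exact hN x
      have h5 := hq (lam (T - (k + 1))) (fun i => (hlam _ (by omega) i).2) x
      have h6 : (K₀ *ᵥ x) ⬝ᵥ (L.R *ᵥ (K₀ *ᵥ x)) ≤ ρ * (κ * ‖x‖) ^ 2 :=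
        (hρ _).trans (by gcongr; exact hκ x)
      have h7 : b * ‖x‖ ^ 2 ≤ b * N x ^ 2 := by gcongr; exact hN1 x
      have h8 : (β * θ ^ 2 + b) * N x ^ 2 ≤ β * N x ^ 2 := by gcongr
      rw [hb] at h7 h8
      simp only [Fback]
      nlinarith
  calc _ ≤ β * N x ^ 2 := key _ (Nat.sub_le _ _) x
    _ ≤ β * (a * ‖x‖) ^ 2 := by
      gcongr
      · exact hN0 x
      · exact hN2 x
    _ = _ := by ring

/-- Uniform exponential stability of the homogeneous closed loop. -/
theorem exists_closedLoop_decay (hL : L.Standing) (Λ : ℝ) :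
    ∃ C α : ℝ, 0 < C ∧ 0 < α ∧ α < 1 ∧ ∀ (T : ℕ) (lam : ℕ → ι → ℝ),
      (∀ t < T, ∀ i, 0 ≤ lam t i ∧ lam t i ≤ Λ) → ∀ r t, r ≤ t → t ≤ T → ∀ z : ℕ → Fin n → ℝ,
        (∀ k, r ≤ k → k < t → z (k + 1) = L.closedLoop (L.F lam T (k + 1)) *ᵥ z k) →
        ‖z t‖ ≤ C * α ^ (t - r) * ‖z r‖ := by
  obtain ⟨β, hβ0, hβ⟩ := exists_form_F_le hL Λ
  obtain ⟨N, θ, a, γ, hθ0, hθ1, ha, hγ, hN1, hN2, hN⟩ := exists_observer_norm hL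
  have hN0 : ∀ x, 0 ≤ N x := fun x => (norm_nonneg x).trans (hN1 x)
  set ω := γ * β + 1 with hω
  have hω1 : 1 ≤ ω := le_add_of_nonneg_left (by positivity)
  have hω0 : 0 < ω := by linarith
  set ρ := 1 - (1 - θ) / ω with hρ
  have hdiv0 : 0 < (1 - θ) / ω := div_pos (by linarith) hω0
  have hdiv1 : (1 - θ) / ω < 1 := by rw [div_lt_one hω0]; linarith
  have hρ0 : 0 < ρ := by linarith
  have hρ1 : ρ < 1 := by linarith
  -- Square roots, because the Lyapunov function is quadratic in the state.
  refine ⟨√ω * a, √ρ, by positivity, Real.sqrt_pos.2 hρ0, ?_, ?_⟩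
  · rw [Real.sqrt_lt' one_pos]; simpa using hρ1
  intro T lam hlam r t hrt htT z hz
  have hlam0 : ∀ t < T, ∀ i, 0 ≤ lam t i := fun t ht i => (hlam t ht i).1
  set W : ℕ → ℝ := fun k => γ * (z k ⬝ᵥ (L.F lam T k *ᵥ z k)) + N (z k) ^ 2 with hW
  have hWle : ∀ k, W k ≤ ω * N (z k) ^ 2 := fun k => by
    have h1 := hβ T lam hlam k (z k)
    have h2 : γ * (z k ⬝ᵥ (L.F lam T k *ᵥ z k)) ≤ γ * (β * N (z k) ^ 2) := by
      gcongr
      refine h1.trans ?_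
      gcongr
      exact hN1 _
    simp only [hW, hω]
    linarith
  have hstep : ∀ k, r ≤ k → k < t → W (k + 1) ≤ ρ * W k := by
    intro k hrk hkt
    have hF := F_posSemidef hL hlam0 (k + 1)
    have h1 := form_riccatiStep_eq hL hF (lam k) (z k)
    -- The actual drop involves `Q_λ`; passing to the smaller `Q` allows one observer norm for all
    -- multipliers.
    have h2 := form_Q_le_form_Qlam hL (hlam0 k (by omega)) (z k)
    have h3 := hN (z k) (-(L.K (L.F lam T (k + 1)) *ᵥ z k))
    have h4 : L.A *ᵥ z k + L.B *ᵥ (-(L.K (L.F lam T (k + 1)) *ᵥ z k)) = z (k + 1) := by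
      rw [hz k hrk hkt, closedLoop, Matrix.sub_mulVec, Matrix.mulVec_neg, Matrix.mulVec_mulVec,
        sub_eq_add_neg]
    rw [h4] at h3
    rw [← F_eq_riccatiStep lam (by omega : k < T), ← hz k hrk hkt] at h1
    simp only [Matrix.mulVec_neg, dotProduct_neg, neg_dotProduct, neg_neg] at h3
    have h5 : (1 - θ) / ω * W k ≤ (1 - θ) * N (z k) ^ 2 := by
      calc _ ≤ (1 - θ) / ω * (ω * N (z k) ^ 2) := by gcongr; exact hWle k
        _ = _ := by field_simp
    have h6 := mul_le_mul_of_nonneg_left h2 hγ.le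
    have h7 := congrArg (γ * ·) h1
    simp only [mul_add] at h7 h3
    have h8 : ρ * W k = W k - (1 - θ) / ω * W k := by rw [hρ]; ring
    rw [h8]
    simp only [hW] at h5 ⊢
    linarith
  have hdecay : ∀ j, r + j ≤ t → W (r + j) ≤ ρ ^ j * W r := by
    intro j
    induction j with
    | zero => simp
    | succ j ih =>
      intro hj
      calc W (r + j + 1) ≤ ρ * W (r + j) := hstep _ (by omega) (by omega)
        _ ≤ ρ * (ρ ^ j * W r) := by gcongr; exact ih (by omega)
        _ = _ := by ring
  have h1 := hdecay (t - r) (by omega)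
  rw [show r + (t - r) = t by omega] at h1
  have h2 : N (z t) ^ 2 ≤ W t :=
    le_add_of_nonneg_left (mul_nonneg hγ.le ((F_posSemidef hL hlam0 t).form_nonneg _))
  have h3 : W r ≤ ω * (a * ‖z r‖) ^ 2 := (hWle r).trans (by gcongr; exacts [hN0 _, hN2 _])
  rw [← pow_le_pow_iff_left₀ (norm_nonneg _) (by positivity) two_ne_zero]
  calc ‖z t‖ ^ 2 ≤ N (z t) ^ 2 := by gcongr; exact hN1 _
    _ ≤ ρ ^ (t - r) * W r := h2.trans h1
    _ ≤ ρ ^ (t - r) * (ω * (a * ‖z r‖) ^ 2) := by gcongr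
    _ = √ω ^ 2 * (√ρ ^ 2) ^ (t - r) * (a * ‖z r‖) ^ 2 := by
      rw [Real.sq_sqrt hω0.le, Real.sq_sqrt hρ0.le]; ring
    _ = _ := by rw [← pow_mul, mul_comm 2, pow_mul]; ring

theorem law_sub_law (D : AffineData n m s ι) (lam : ℕ → ι → ℝ) (mu : ℕ → Fin s → ℝ) (T k : ℕ)
    (x y : Fin n → ℝ) :
    (L.A *ᵥ x + L.B *ᵥ L.law D lam mu T k x) - (L.A *ᵥ y + L.B *ᵥ L.law D lam mu T k y)
      = L.closedLoop (L.F lam T (k + 1)) *ᵥ (x - y) := by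
  simp only [law, closedLoop, Matrix.sub_mulVec, Matrix.mulVec_sub, Matrix.mulVec_add,
    Matrix.mulVec_neg, ← Matrix.mulVec_mulVec]
  abel

end LQR

/-! ### Limits of matrix expressions and of affine iterations. -/

section MatrixLimits

variable {n : ℕ}

/-- The constant is explicit in the entries, so it tends to zero under entrywise convergence to
zero. -/
theorem Matrix.norm_mulVec_le_sum_abs (A : Matrix (Fin n) (Fin n) ℝ) (x : Fin n → ℝ) :
    ‖A *ᵥ x‖ ≤ (∑ i, ∑ j, |A i j|) * ‖x‖ := by
  rw [pi_norm_le_iff_of_nonneg (by positivity)]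
  intro i
  have h1 : ∑ j, |A i j| ≤ ∑ i, ∑ j, |A i j| :=
    Finset.single_le_sum (f := fun i => ∑ j, |A i j|)
      (fun i _ => Finset.sum_nonneg fun j _ => abs_nonneg _) (Finset.mem_univ i)
  refine le_trans ?_ (mul_le_mul_of_nonneg_right h1 (norm_nonneg x))
  rw [Finset.sum_mul, Real.norm_eq_abs, Matrix.mulVec, dotProduct]
  refine (Finset.abs_sum_le_sum_abs _ _).trans (Finset.sum_le_sum fun j _ => ?_)
  rw [abs_mul]
  exact mul_le_mul_of_nonneg_left (norm_le_pi_norm x j) (abs_nonneg _)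

theorem Filter.Tendsto.matrix_mul {p q r : ℕ} {β : Type*} {l : Filter β}
    {A : β → Matrix (Fin p) (Fin q) ℝ} {B : β → Matrix (Fin q) (Fin r) ℝ} {A₀ B₀}
    (hA : Tendsto A l (𝓝 A₀)) (hB : Tendsto B l (𝓝 B₀)) :
    Tendsto (fun b => A b * B b) l (𝓝 (A₀ * B₀)) :=
  ((continuous_fst.matrix_mul continuous_snd).tendsto (A₀, B₀)).comp (hA.prodMk_nhds hB)

theorem Filter.Tendsto.matrix_mulVec {p q : ℕ} {β : Type*} {l : Filter β}
    {A : β → Matrix (Fin p) (Fin q) ℝ} {x : β → Fin q → ℝ} {A₀ x₀}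
    (hA : Tendsto A l (𝓝 A₀)) (hx : Tendsto x l (𝓝 x₀)) :
    Tendsto (fun b => A b *ᵥ x b) l (𝓝 (A₀ *ᵥ x₀)) :=
  ((continuous_fst.matrix_mulVec continuous_snd).tendsto (A₀, x₀)).comp (hA.prodMk_nhds hx)

theorem Filter.Tendsto.matrix_transpose {p q : ℕ} {β : Type*} {l : Filter β}
    {A : β → Matrix (Fin p) (Fin q) ℝ} {A₀} (hA : Tendsto A l (𝓝 A₀)) :
    Tendsto (fun b => (A b)ᵀ) l (𝓝 A₀ᵀ) :=
  (continuous_id.matrix_transpose.tendsto A₀).comp hA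

theorem Filter.Tendsto.matrix_inv {β : Type*} {l : Filter β}
    {A : β → Matrix (Fin n) (Fin n) ℝ} {A₀} (hA : Tendsto A l (𝓝 A₀)) (h₀ : IsUnit A₀.det) :
    Tendsto (fun b => (A b)⁻¹) l (𝓝 A₀⁻¹) := by
  simp only [Matrix.inv_def, Ring.inverse_eq_inv']
  have hdet : Tendsto (fun b => (A b).det) l (𝓝 A₀.det) :=
    (continuous_id.matrix_det.tendsto A₀).comp hA
  exact (hdet.inv₀ h₀.ne_zero).smul ((continuous_id.matrix_adjugate.tendsto A₀).comp hA)

/-- Affine iterations with converging coefficients and Schur stable limit matrix converge. -/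
theorem SchurStable.exists_tendsto_affine_iterate {A : Matrix (Fin n) (Fin n) ℝ}
    (hA : SchurStable A) {A' : ℕ → Matrix (Fin n) (Fin n) ℝ} (hA' : Tendsto A' atTop (𝓝 A))
    {w : Fin n → ℝ} {w' : ℕ → Fin n → ℝ} (hw' : Tendsto w' atTop (𝓝 w)) {v : ℕ → Fin n → ℝ}
    (hv : ∀ k, v (k + 1) = A' k *ᵥ v k + w' k) : ∃ v₀, Tendsto v atTop (𝓝 v₀) := by
  obtain ⟨v₀, hv₀⟩ := hA.exists_equilibrium w
  obtain ⟨N, θ, a, hθ0, hθ1, ha, hN1, hN2, hNadd, hN⟩ := hA.exists_adapted_norm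
  have hN0 : ∀ x, 0 ≤ N x := fun x => (norm_nonneg x).trans (hN1 x)
  refine ⟨v₀, ?_⟩
  have hsub : Tendsto (fun k => A' k - A) atTop (𝓝 0) := by
    simpa using hA'.sub_const A
  have hη : Tendsto (fun k => ∑ i, ∑ j, |(A' k - A) i j|) atTop (𝓝 0) := by
    have : Tendsto (fun k => ∑ i, ∑ j, |(A' k - A) i j|) atTop
        (𝓝 (∑ i : Fin n, ∑ j : Fin n, |(0 : Matrix (Fin n) (Fin n) ℝ) i j|)) :=
      tendsto_finsetSum _ fun i _ => tendsto_finsetSum _ fun j _ =>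
        (tendsto_pi_nhds.1 (tendsto_pi_nhds.1 hsub i) j).abs
    simpa using this
  have hδ : Tendsto (fun k => a * ‖(A' k - A) *ᵥ v₀ + (w' k - w)‖) atTop (𝓝 0) := by
    have h1 := (hsub.matrix_mulVec (tendsto_const_nhds (x := v₀))).add (hw'.sub_const w)
    simpa using h1.norm.const_mul a
  have hlim : Tendsto (fun k => N (v k - v₀)) atTop (𝓝 0) := by
    -- Half of the gap `1 - θ` absorbs the perturbation `A' k - A`.
    refine tendsto_zero_of_le_mul_add (θ := (1 + θ) / 2) (by linarith) (by linarith)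
      (fun k => hN0 _) hδ ?_
    have hη' : Tendsto (fun k => a * ∑ i, ∑ j, |(A' k - A) i j|) atTop (𝓝 0) := by
      simpa using hη.const_mul a
    filter_upwards [hη'.eventually (gt_mem_nhds (by linarith : (0 : ℝ) < (1 - θ) / 2))] with k hk
    have hdec : v (k + 1) - v₀ = A *ᵥ (v k - v₀) + ((A' k - A) *ᵥ (v k - v₀)
        + ((A' k - A) *ᵥ v₀ + (w' k - w))) := by
      conv_lhs => rw [hv k, hv₀]
      simp only [Matrix.sub_mulVec, Matrix.mulVec_sub]
      abel
    have h2 : N ((A' k - A) *ᵥ (v k - v₀)) ≤ (1 - θ) / 2 * N (v k - v₀) := by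
      calc _ ≤ a * ‖(A' k - A) *ᵥ (v k - v₀)‖ := hN2 _
        _ ≤ a * ((∑ i, ∑ j, |(A' k - A) i j|) * ‖v k - v₀‖) := by
          gcongr; exact Matrix.norm_mulVec_le_sum_abs _ _
        _ = (a * ∑ i, ∑ j, |(A' k - A) i j|) * ‖v k - v₀‖ := by ring
        _ ≤ _ := by gcongr; exact hN1 _
    rw [hdec]
    have h3 := hNadd (A *ᵥ (v k - v₀)) ((A' k - A) *ᵥ (v k - v₀)
        + ((A' k - A) *ᵥ v₀ + (w' k - w)))
    have h4 := hNadd ((A' k - A) *ᵥ (v k - v₀)) ((A' k - A) *ᵥ v₀ + (w' k - w))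
    have h5 := hN (v k - v₀)
    have h6 := hN2 ((A' k - A) *ᵥ v₀ + (w' k - w))
    linarith
  rw [tendsto_iff_norm_sub_tendsto_zero]
  exact squeeze_zero (fun k => norm_nonneg _) (fun k => hN1 _) hlim

end MatrixLimits

/-! ### Convergence as the horizon grows. -/

namespace LQR

section Gain

variable {n m : ℕ} {ι : Type*} {L : LQR n m ι} {F : Matrix (Fin n) (Fin n) ℝ}

theorem closedLoop_transpose_mul_mul_B (hL : L.Standing) (hF : F.PosSemidef) :
    (L.closedLoop F)ᵀ * F * L.B = (L.K F)ᵀ * L.R := by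
  rw [closedLoop, Matrix.transpose_sub, Matrix.transpose_mul, Matrix.sub_mul, Matrix.sub_mul,
    ← K_transpose_mul_M hL hF, M, Matrix.mul_add]
  simp only [Matrix.mul_assoc]
  abel

theorem B_transpose_mul_mul_closedLoop (hL : L.Standing) (hF : F.PosSemidef) :
    L.Bᵀ * F * L.closedLoop F = L.R * L.K F := by
  rw [closedLoop, Matrix.mul_sub, ← M_mul_K (isUnit_det_M hL hF), M, Matrix.add_mul]
  simp only [Matrix.mul_assoc]
  abel

theorem tendsto_M {β : Type*} {f : Filter β} {F' : β → Matrix (Fin n) (Fin n) ℝ}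
    (h : Tendsto F' f (𝓝 F)) : Tendsto (fun b => L.M (F' b)) f (𝓝 (L.M F)) :=
  ((tendsto_const_nhds.matrix_mul h).matrix_mul tendsto_const_nhds).add_const _

theorem tendsto_M_inv (hL : L.Standing) (hF : F.PosSemidef) {β : Type*} {f : Filter β}
    {F' : β → Matrix (Fin n) (Fin n) ℝ} (h : Tendsto F' f (𝓝 F)) :
    Tendsto (fun b => (L.M (F' b))⁻¹) f (𝓝 (L.M F)⁻¹) :=
  (tendsto_M h).matrix_inv (isUnit_det_M hL hF)

theorem tendsto_K (hL : L.Standing) (hF : F.PosSemidef) {β : Type*} {f : Filter β}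
    {F' : β → Matrix (Fin n) (Fin n) ℝ} (h : Tendsto F' f (𝓝 F)) :
    Tendsto (fun b => L.K (F' b)) f (𝓝 (L.K F)) :=
  (((tendsto_M_inv hL hF h).matrix_mul tendsto_const_nhds).matrix_mul h).matrix_mul
    tendsto_const_nhds

theorem tendsto_closedLoop (hL : L.Standing) (hF : F.PosSemidef) {β : Type*} {f : Filter β}
    {F' : β → Matrix (Fin n) (Fin n) ℝ} (h : Tendsto F' f (𝓝 F)) :
    Tendsto (fun b => L.closedLoop (F' b)) f (𝓝 (L.closedLoop F)) :=
  tendsto_const_nhds.sub (tendsto_const_nhds.matrix_mul (tendsto_K hL hF h))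

end Gain

variable {n m s : ℕ} {ι : Type*} [Fintype ι] {L : LQR n m ι}

/-- Expanding the right side through either closed loop produces the same cross term `K₁ᵀ R K₂`,
since `Bᵀ F (A - B K) = R K`; it cancels. -/
theorem riccatiStep_sub_riccatiStep (hL : L.Standing) {F₁ F₂ : Matrix (Fin n) (Fin n) ℝ}
    (h₁ : F₁.PosSemidef) (h₂ : F₂.PosSemidef) (lam : ι → ℝ) :
    L.riccatiStep lam F₁ - L.riccatiStep lam F₂
      = (L.closedLoop F₁)ᵀ * (F₁ - F₂) * L.closedLoop F₂ := by
  have e₁ : L.riccatiStep lam F₁ = L.Qlam lam + (L.closedLoop F₁)ᵀ * F₁ * L.A := by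
    rw [riccatiStep_eq_sub hL h₁, Matrix.mul_assoc (L.K F₁)ᵀ, M_mul_K (isUnit_det_M hL h₁),
      closedLoop, Matrix.transpose_sub, Matrix.transpose_mul, Matrix.sub_mul, Matrix.sub_mul]
    simp only [Matrix.mul_assoc]
    abel
  have e₂ : L.riccatiStep lam F₂ = L.Qlam lam + L.Aᵀ * F₂ * L.closedLoop F₂ := by
    rw [riccatiStep_eq_sub hL h₂, K_transpose_mul_M hL h₂, closedLoop, Matrix.mul_sub]
    simp only [Matrix.mul_assoc]
    abel
  have c₁ : (L.closedLoop F₁)ᵀ * F₁ * L.closedLoop F₂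
      = (L.closedLoop F₁)ᵀ * F₁ * L.A - (L.K F₁)ᵀ * L.R * L.K F₂ := by
    rw [← closedLoop_transpose_mul_mul_B hL h₁, closedLoop, closedLoop, Matrix.mul_sub]
    simp only [Matrix.mul_assoc]
  have c₂ : (L.closedLoop F₁)ᵀ * F₂ * L.closedLoop F₂
      = L.Aᵀ * F₂ * L.closedLoop F₂ - (L.K F₁)ᵀ * L.R * L.K F₂ := by
    rw [Matrix.mul_assoc (L.K F₁)ᵀ, ← B_transpose_mul_mul_closedLoop hL h₂,
      closedLoop.eq_1 L F₁, Matrix.transpose_sub, Matrix.transpose_mul, Matrix.sub_mul,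
      Matrix.sub_mul]
    simp only [Matrix.mul_assoc]
  rw [e₁, e₂, Matrix.mul_sub, Matrix.sub_mul, c₁, c₂]
  abel

/-- The homogeneous closed-loop trajectory for the horizon `T` that starts in `x` at time `0`. -/
def homTrajectory (L : LQR n m ι) (lam : ℕ → ι → ℝ) (T : ℕ) (x : Fin n → ℝ) : ℕ → Fin n → ℝ
  | 0 => x
  | k + 1 => L.closedLoop (L.F lam T (k + 1)) *ᵥ homTrajectory L lam T x k

/-- The difference of the cost-to-go matrices of two horizons is transported along the two
homogeneous closed loops. -/
theorem form_F_sub_F (hL : L.Standing) {lam : ℕ → ι → ℝ} {T₁ T₂ : ℕ} (h₁₂ : T₂ ≤ T₁)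
    (hlam : ∀ t < T₁, ∀ i, 0 ≤ lam t i) (x y : Fin n → ℝ) :
    ∀ t ≤ T₂, L.homTrajectory lam T₁ x t ⬝ᵥ
        ((L.F lam T₁ t - L.F lam T₂ t) *ᵥ L.homTrajectory lam T₂ y t)
      = x ⬝ᵥ ((L.F lam T₁ 0 - L.F lam T₂ 0) *ᵥ y) := by
  intro t
  induction t with
  | zero => exact fun _ => rfl
  | succ t ih =>
    intro ht
    rw [← ih (by omega), F_eq_riccatiStep lam (by omega : t < T₁),
      F_eq_riccatiStep lam (by omega : t < T₂), riccatiStep_sub_riccatiStep hL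
        (F_posSemidef hL hlam _) (F_posSemidef hL (fun t ht => hlam t (by omega)) _),
      Matrix.dotProduct_congr_mulVec, homTrajectory, homTrajectory]

/-- Only the number of steps to go matters for constant multipliers, so the truncated time index in
the recursion is harmless even when `k > T`. -/
theorem Fback_eq_F_zero {lam : ℕ → ι → ℝ} (hlam : ∀ t, lam t = lam 0) (T k : ℕ) :
    L.Fback lam T k = L.F lam k 0 := by
  have h : ∀ T₁ T₂, L.Fback lam T₁ k = L.Fback lam T₂ k := fun T₁ T₂ => by
    induction k with
    | zero => rfl
    | succ k ih => simp only [Fback]; rw [ih, hlam (T₁ - _), hlam (T₂ - _)]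
  rw [LQR.F, Nat.sub_zero]
  exact h _ _

theorem Sback_eq_S_zero {D : AffineData n m s ι} {lam : ℕ → ι → ℝ} {mu : ℕ → Fin s → ℝ}
    (hc : ∀ t, D.c t = D.c 0) (hG : ∀ t, D.G t = D.G 0) (hlam : ∀ t, lam t = lam 0)
    (hmu : ∀ t, mu t = mu 0) (T k : ℕ) : L.Sback D lam mu T k = L.S D lam mu k 0 := by
  have h : ∀ T₁ T₂, L.Sback D lam mu T₁ k = L.Sback D lam mu T₂ k := fun T₁ T₂ => by
    induction k with
    | zero => rfl
    | succ k ih =>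
      simp only [Sback, linStep]
      rw [ih, hlam (T₁ - _), hlam (T₂ - _), hc (T₁ - _), hc (T₂ - _), hG (T₁ - _), hG (T₂ - _),
        hmu (T₁ - _), hmu (T₂ - _), Fback_eq_F_zero hlam, Fback_eq_F_zero hlam]
  rw [LQR.S, Nat.sub_zero]
  exact h _ _

/-- With constant multipliers the cost-to-go matrices converge as the horizon grows. -/
theorem exists_tendsto_F (hL : L.Standing) {lam : ℕ → ι → ℝ} (hconst : ∀ t, lam t = lam 0)
    (hlam : ∀ i, 0 ≤ lam 0 i) {C α : ℝ} (hC : 0 < C) (hα0 : 0 < α) (hα1 : α < 1)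
    (hdecay : ∀ T t, t ≤ T → ∀ x, ‖L.homTrajectory lam T x t‖ ≤ C * α ^ t * ‖x‖) :
    ∃ Finf, Finf.PosSemidef ∧ Tendsto (fun k => L.F lam k 0) atTop (𝓝 Finf) := by
  have hlam' : ∀ t i, 0 ≤ lam t i := fun t => by rw [hconst t]; exact hlam
  obtain ⟨c, hc0, hc⟩ := (L.F lam 1 0 - L.P).exists_abs_form_le
  have hone : ∀ i : Fin n, ‖(Pi.single i 1 : Fin n → ℝ)‖ ≤ 1 := fun i => by
    rw [Pi.norm_single, norm_one]
  have hentry : ∀ i j k, dist (L.F lam k 0 i j) (L.F lam (k + 1) 0 i j)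
      ≤ c * C ^ 2 * (α ^ 2) ^ k := by
    intro i j k
    -- Transport up to time `k`, the end of the shorter horizon: there the difference is the fixed
    -- matrix `F lam 1 0 - P`, and each trajectory contributes a factor `C αᵏ`. Monotonicity in the
    -- horizon is not needed.
    have h1 := form_F_sub_F hL (Nat.le_succ k) (fun t _ => hlam' t) (Pi.single i 1)
      (Pi.single j 1) k le_rfl
    have h2 : L.F lam (k + 1) k = L.F lam 1 0 := by
      rw [LQR.F, Fback_eq_F_zero hconst, Nat.add_sub_cancel_left]
    rw [Nat.succ_eq_add_one, h2, F_self] at h1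
    have h3 := hc (L.homTrajectory lam (k + 1) (Pi.single i 1) k)
      (L.homTrajectory lam k (Pi.single j 1) k)
    rw [h1] at h3
    have h4 : (Pi.single i 1 : Fin n → ℝ) ⬝ᵥ
        ((L.F lam (k + 1) 0 - L.F lam k 0) *ᵥ (Pi.single j 1))
        = L.F lam (k + 1) 0 i j - L.F lam k 0 i j := by
      simp
    rw [h4] at h3
    rw [dist_comm, Real.dist_eq]
    refine h3.trans ?_
    have h5 := hdecay (k + 1) k (by omega) (Pi.single i 1)
    have h6 := hdecay k k le_rfl (Pi.single j 1)
    have h7 : ∀ i : Fin n, C * α ^ k * ‖(Pi.single i 1 : Fin n → ℝ)‖ ≤ C * α ^ k :=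
      fun i => mul_le_of_le_one_right (by positivity) (hone i)
    calc _ ≤ c * ((C * α ^ k) * (C * α ^ k)) := by
          gcongr
          exacts [h5.trans (h7 i), h6.trans (h7 j)]
      _ = _ := by rw [← pow_mul, mul_comm 2, pow_mul]; ring
  have hlim : ∀ i j, ∃ f, Tendsto (fun k => L.F lam k 0 i j) atTop (𝓝 f) := fun i j =>
    cauchySeq_tendsto_of_complete
      (cauchySeq_of_le_geometric _ _ (by nlinarith) (hentry i j))
  choose f hf using hlim
  have hF : Tendsto (fun k => L.F lam k 0) atTop (𝓝 (Matrix.of f)) :=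
    tendsto_pi_nhds.2 fun i => tendsto_pi_nhds.2 fun j => hf i j
  have hpos : ∀ k, (L.F lam k 0).PosSemidef := fun k => F_posSemidef hL (fun t _ => hlam' t) 0
  refine ⟨Matrix.of f, Matrix.PosSemidef.of_dotProduct_mulVec_nonneg ?_ fun x => ?_, hF⟩
  · refine (Matrix.conjTranspose_eq_transpose_of_trivial _).trans
      (tendsto_nhds_unique hF.matrix_transpose ?_)
    simpa only [(hpos _).transpose_eq] using hF
  · have hx := hF.matrix_mulVec (tendsto_const_nhds (x := x))
    refine ge_of_tendsto' (((continuous_const.dotProduct continuous_id).tendsto _).comp hx)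
      fun k => ?_
    simpa using (hpos k).form_nonneg x

end LQR

end

/-! ### The three statements and the stationary law. -/

theorem theorem2 {n m : ℕ} {ι : Type*} [Fintype ι] (L : LQR n m ι) (hL : L.Standing) :
    -- detectability is kept by every nonnegative multiplier
    (∀ lam : ι → ℝ, (∀ i, 0 ≤ lam i) → Detectable L.A (CFC.sqrt (L.Qlam lam))) ∧
    -- the law attains the minimum of the cost-to-go, from every time and state
    (∀ (s : ℕ) (D : AffineData n m s ι) (T : ℕ) (lam : ℕ → ι → ℝ) (mu : ℕ → Fin s → ℝ),
      (∀ t < T, ∀ i, 0 ≤ lam t i) → (∀ t < T, ∀ j, 0 ≤ mu t j) →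
      ∀ t ≤ T, ∀ (x y : ℕ → Fin n → ℝ) (u : ℕ → Fin m → ℝ),
        L.IsTrajectory t T y u →
        L.IsTrajectory t T x (fun k => L.law D lam mu T k (x k)) → x t = y t →
        L.costToGo D lam mu T t x (fun k => L.law D lam mu T k (x k)) ≤
          L.costToGo D lam mu T t y u) ∧
    -- the law stabilizes the system, uniformly in the horizon
    (∀ Λ : ℝ, ∃ C α : ℝ, 0 < C ∧ 0 < α ∧ α < 1 ∧
      (∀ (s : ℕ) (D : AffineData n m s ι) (T : ℕ) (lam : ℕ → ι → ℝ) (mu : ℕ → Fin s → ℝ),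
        (∀ t < T, ∀ i, 0 ≤ lam t i ∧ lam t i ≤ Λ) → (∀ t < T, ∀ j, 0 ≤ mu t j) →
        ∀ r t : ℕ, r ≤ t → t ≤ T → ∀ x y : ℕ → Fin n → ℝ,
          L.IsTrajectory r T x (fun k => L.law D lam mu T k (x k)) →
          L.IsTrajectory r T y (fun k => L.law D lam mu T k (y k)) →
          ‖x t - y t‖ ≤ C * α ^ (t - r) * ‖x r - y r‖) ∧
      -- time-invariant data: the limiting stationary law and its closed loop
      (∀ (s : ℕ) (D : AffineData n m s ι) (lam : ℕ → ι → ℝ) (mu : ℕ → Fin s → ℝ),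
        (∀ t, D.c t = D.c 0) → (∀ t, D.G t = D.G 0) →
        (∀ t, lam t = lam 0) → (∀ t, mu t = mu 0) →
        (∀ i, 0 ≤ lam 0 i ∧ lam 0 i ≤ Λ) → (∀ j, 0 ≤ mu 0 j) →
        ∃ (Kinf : Matrix (Fin m) (Fin n) ℝ) (linf : Fin m → ℝ) (xbar : Fin n → ℝ),
          (∀ t, Tendsto (fun T => L.K (L.F lam T (t + 1))) atTop (𝓝 Kinf)) ∧
          (∀ t, Tendsto (fun T => L.offset D lam mu T t) atTop (𝓝 linf)) ∧
          SchurStable (L.A - L.B * Kinf) ∧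
          xbar = L.A *ᵥ xbar + L.B *ᵥ (-(Kinf *ᵥ xbar) + linf) ∧
          ∀ x : ℕ → Fin n → ℝ,
            (∀ t, x (t + 1) = L.A *ᵥ x t + L.B *ᵥ (-(Kinf *ᵥ x t) + linf)) →
            ∀ t, ‖x t - xbar‖ ≤ C * α ^ t * ‖x 0 - xbar‖)) := by
  refine ⟨fun lam hlam => LQR.detectable_sqrt_Qlam hL hlam,
    fun s D T lam mu hlam _ t ht x y u hy hx hxy => LQR.costToGo_law_le hL D mu hlam ht hy hx hxy,
    fun Λ => ?_⟩
  obtain ⟨C, α, hC, hα0, hα1, hdecay⟩ := LQR.exists_closedLoop_decay hL Λ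
  refine ⟨C, α, hC, hα0, hα1, fun s D T lam mu hlam _ r t hrt htT x y hx hy => ?_,
    fun s D lam mu hc hG hconst hmu hlam _ => ?_⟩
  · refine hdecay T lam hlam r t hrt htT (fun k => x k - y k) fun k hrk hkt => ?_
    simp only [hx k hrk (by omega), hy k hrk (by omega)]
    exact LQR.law_sub_law D lam mu T k (x k) (y k)
  have hhom : ∀ T t, t ≤ T → ∀ x, ‖L.homTrajectory lam T x t‖ ≤ C * α ^ t * ‖x‖ :=
    fun T t ht x => hdecay T lam (fun t _ => by rw [hconst t]; exact hlam) 0 t (Nat.zero_le t) ht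
      (L.homTrajectory lam T x) fun k _ _ => rfl
  obtain ⟨Finf, hFinf, hF⟩ := LQR.exists_tendsto_F hL hconst (fun i => (hlam i).1) hC hα0 hα1 hhom
  have hFt : ∀ t, Tendsto (fun T => L.F lam T t) atTop (𝓝 Finf) := fun t => by
    have h : ∀ T, L.F lam T t = L.F lam (T - t) 0 := fun T => LQR.Fback_eq_F_zero hconst T _
    simp only [h]
    exact hF.comp (tendsto_sub_atTop_nat t)
  -- For fixed `t`, finite-horizon trajectories tend to those of the limiting loop as `T → ∞`, so
  -- the bound passes over with the same `C` and `α`.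
  have hpow : ∀ t x, ‖L.closedLoop Finf ^ t *ᵥ x‖ ≤ C * α ^ t * ‖x‖ := fun t x => by
    have hlim : Tendsto (fun T => L.homTrajectory lam T x t) atTop
        (𝓝 (L.closedLoop Finf ^ t *ᵥ x)) := by
      induction t with
      | zero => simp [LQR.homTrajectory]
      | succ t ih =>
        rw [pow_succ', ← Matrix.mulVec_mulVec]
        exact (LQR.tendsto_closedLoop hL hFinf (hFt (t + 1))).matrix_mulVec ih
    exact le_of_tendsto hlim.norm ((eventually_ge_atTop t).mono fun T hT => hhom T t hT x)
  have hstable : SchurStable (L.closedLoop Finf) := schurStable_of_pow_mulVec_le hα0.le hα1 hpow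
  obtain ⟨Sinf, hS⟩ : ∃ Sinf, Tendsto (fun k => L.S D lam mu k 0) atTop (𝓝 Sinf) := by
    -- Regrouped, the recursion for `S` is affine with matrix `(A - B K)ᵀ`, evaluated at the
    -- converging `F`.
    refine hstable.transpose.exists_tendsto_affine_iterate
      (A' := fun k => (L.closedLoop (L.F lam k 0))ᵀ)
      (LQR.tendsto_closedLoop hL hFinf hF).matrix_transpose
      (w' := fun k => (∑ i, lam 0 i • D.c 0 i)
        - (L.K (L.F lam k 0))ᵀ *ᵥ ((D.G 0)ᵀ *ᵥ mu 0))
      (tendsto_const_nhds.sub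
        ((LQR.tendsto_K hL hFinf hF).matrix_transpose.matrix_mulVec tendsto_const_nhds))
      fun k => ?_
    have h1 : L.S D lam mu (k + 1) (0 + 1) = L.S D lam mu k 0 := by
      rw [LQR.S, LQR.Sback_eq_S_zero hc hG hconst hmu]; rfl
    have h2 : L.F lam (k + 1) (0 + 1) = L.F lam k 0 := by
      rw [LQR.F, LQR.Fback_eq_F_zero hconst]; rfl
    rw [LQR.S_eq_linStep D lam mu (Nat.succ_pos k), h1, h2, LQR.linStep, LQR.closedLoop,
      Matrix.transpose_sub, Matrix.transpose_mul, Matrix.sub_mulVec, Matrix.mulVec_add,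
      ← Matrix.mulVec_mulVec]
    abel
  have hSt : ∀ t, Tendsto (fun T => L.S D lam mu T t) atTop (𝓝 Sinf) := fun t => by
    have h : ∀ T, L.S D lam mu T t = L.S D lam mu (T - t) 0 :=
      fun T => LQR.Sback_eq_S_zero hc hG hconst hmu T _
    simp only [h]
    exact hS.comp (tendsto_sub_atTop_nat t)
  set linf := -((1 / 2 : ℝ) • ((L.M Finf)⁻¹ *ᵥ (L.Bᵀ *ᵥ Sinf + (D.G 0)ᵀ *ᵥ mu 0)))
  have haffine : ∀ x, L.A *ᵥ x + L.B *ᵥ (-(L.K Finf *ᵥ x) + linf)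
      = L.closedLoop Finf *ᵥ x + L.B *ᵥ linf := fun x => by
    rw [LQR.closedLoop, Matrix.sub_mulVec, Matrix.mulVec_add, Matrix.mulVec_neg,
      ← Matrix.mulVec_mulVec]
    abel
  obtain ⟨xbar, hxbar⟩ := hstable.exists_equilibrium (L.B *ᵥ linf)
  refine ⟨L.K Finf, linf, xbar, fun t => LQR.tendsto_K hL hFinf (hFt (t + 1)), fun t => ?_,
    hstable, by rw [haffine]; exact hxbar, fun x hx t => ?_⟩
  · simp only [LQR.offset, hG t, hmu t]
    exact (((LQR.tendsto_M_inv hL hFinf (hFt (t + 1))).matrix_mulVec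
      ((tendsto_const_nhds.matrix_mulVec (hSt (t + 1))).add_const _)).const_smul _).neg
  · have h : x t - xbar = L.closedLoop Finf ^ t *ᵥ (x 0 - xbar) := by
      induction t with
      | zero => simp
      | succ t ih =>
        rw [pow_succ', ← Matrix.mulVec_mulVec, ← ih, hx, haffine, Matrix.mulVec_sub]
        conv_lhs => rw [hxbar]
        abel
    rw [h]
    exact hpow t _
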